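/- **Setting.** An MPO tensor $\mathcal V$ assigns to each output index $o$ (physical output together with purification leg, finitely many values) and each input index $i\in\{1,\dots,d_{\rm in}\}$, $d_{\rm in}\ge 1$, a complex matrix $\mathcal V^{oi}$ on a finite-dimensional bond space. It generates on $N\ge 1$ sites the operator $V_N$ with entries $(V_N)_{o_1\dots o_N,\,i_1\dots i_N}=\operatorname{tr}(\mathcal V^{o_1i_1}\cdots\mathcal V^{o_Ni_N})$. The tensor generates an sMPI with constant $c>0$ if $V_N^\dagger V_N=c\,\mathbb 1$ for all $N\ge 1$. For tensors $A,B$ with the same physical indices put $\mathbb E(A,B)=\frac1{d_{\rm in}}\sum_{o,i}A^{oi}\otimes\overline{B^{oi}}$; $A$ and $B$ are weakly orthogonal if $\mathbb E(A,B)=0$. A tensor $A$ is normal if (a) every projector $P$ with $A^{oi}P=PA^{oi}P$ for all $o,i$ is $0$ or $\mathbb 1$, and (b) $\mathbb E(A,A)$ has spectral radius $1$, and $1$ is its only eigenvalue of modulus $1$. Normal tensors $A_1,\dots,A_g$ form a basis of normal tensors (BNT) for $\mathcal V$ if for each $N\ge 1$ the operator generated by $\mathcal V$ is a linear combination of those generated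 by the $A_j$, and the latter are linearly independent for all sufficiently large $N$. A canonical form of $\mathcal V$ is a tensor $\bigoplus_{j=1}^g\bigoplus_{q=1}^{m_j}\mu_{j,q}A_j$ with $m_j\ge1$ and $\mu_{j,q}\ne0$, where $\{A_j\}$ is a BNT for $\mathcal V$, which generates the same operators $V_N$ as $\mathcal V$ for all $N\ge 1$. Blocking $L$ sites replaces $\mathcal V$ by the tensor $\mathcal V_{[L]}$ with matrices $\mathcal V^{o_1i_1}\cdots\mathcal V^{o_Li_L}$ (so that $d_{\rm in}$ becomes $d_{\rm in}^L$). **Lemma.** Let $\mathcal V$ generate an sMPI with constant $c$. Then $\mathcal V$ has a canonical form; moreover it has one for which, in a suitable basis of the bond space, $\mathcal V$ is block upper triangular with block-diagonal part equal to the canonical form together with zero blocks. For every canonical form of $\mathcal V$ as above the following holds. (i) There are phases $\varphi_j$, $|\varphi_j|=1$, with $\mu_{j,q}=\varphi_j$ for all $q$. Hence, with $\mathcal V_j=\varphi_jA_j$, the canonical form equals $\bigoplus_{j=1}^g(\mathbb 1_{m_j}\otimes\mathcal V_j)$, and $\{\mathcal V_j\}$ is a BNT for $\mathcal V$. For $j\ne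 j'$ the matrix $\mathbb E_{jj'}=\mathbb E(\mathcal V_j,\mathcal V_{j'})$ is nilpotent, and the blocks become weakly orthogonal after blocking as in (iii). (ii) $\sum_{j=1}^g m_j^2=c$; in particular $c$ is an integer. (iii) There is $L_0\ge1$ (independent of the system size $N$) such that for every $L\ge L_0$, after blocking $L$ sites: the blocked tensors $(\mathcal V_j)_{[L]}$ form a BNT for $\mathcal V_{[L]}$, the blocked canonical form equals $\bigoplus_j(\mathbb 1_{m_j}\otimes(\mathcal V_j)_{[L]})$, the blocks are weakly orthogonal, i.e. $\mathbb E((\mathcal V_j)_{[L]},(\mathcal V_{j'})_{[L]})=0$ for all $j\ne j'$, and for every $j$ the matrix $\mathbb E_{jj}=\mathbb E((\mathcal V_j)_{[L]},(\mathcal V_j)_{[L]})$ has $1$ as a (algebraically) simple eigenvalue, has spectral radius $1$, and satisfies $\mathbb E_{jj}^2=\mathbb E_{jj}$. -/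

import Mathlib

open scoped Kronecker

noncomputable section

/-- A homogeneous matrix product operator tensor: for every value `o` of the output index (the
physical output leg together with the purification leg, if any) and every value `i` of the input
index, a square matrix on the bond space. -/
abbrev MPOTensor (O I B : Type*) := O → I → Matrix B B ℂ

section Tensors

variable {O I B B' : Type*} [Fintype O] [Fintype I] [Fintype B] [Fintype B']
  [DecidableEq O] [DecidableEq I] [DecidableEq B] [DecidableEq B']

/-- The operator `V_N` on `N` sites with periodic boundary conditions. Its entries are also the
coefficients of the matrix product state generated by the tensor when the output and input legs
are grouped into one physical leg. -/
def mpo (V : MPOTensor O I B) (N : ℕ) : Matrix (Fin N → O) (Fin N → I) ℂ :=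
  fun o i => ((List.ofFn fun k => V (o k) (i k)).prod).trace

/-- `V` generates a scaled homogeneous matrix product isometry with normalization constant `c`. -/
def GeneratesSMPI (V : MPOTensor O I B) (c : ℝ) : Prop :=
  0 < c ∧ ∀ N : ℕ, 1 ≤ N → (mpo V N).conjTranspose * mpo V N = (c : ℂ) • 1

/-- The (mixed) transfer matrix `(1 / d_in) ∑_{o,i} V^{oi} ⊗ conj (W^{oi})`. -/
def transfer (V : MPOTensor O I B) (W : MPOTensor O I B') : Matrix (B × B') (B × B') ℂ :=
  ((Fintype.card I : ℂ)⁻¹) • ∑ o, ∑ i, V o i ⊗ₖ (W o i).map (starRingEnd ℂ)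

/-- Two tensors are weakly orthogonal if their mixed transfer matrix vanishes. -/
def WeaklyOrthogonal (V : MPOTensor O I B) (W : MPOTensor O I B') : Prop :=
  transfer V W = 0

/-- The tensor obtained by grouping `L` consecutive sites into one. -/
def blocked (V : MPOTensor O I B) (L : ℕ) : MPOTensor (Fin L → O) (Fin L → I) B :=
  fun o i => (List.ofFn fun k => V (o k) (i k)).prod

/-- Normal tensors: there is no non-trivial invariant projector, and the transfer matrix has
spectral radius one and the number `1` as its only eigenvalue of modulus one. -/
def IsNormalTensor (V : MPOTensor O I B) : Prop :=
  (∀ P : Matrix B B ℂ, P * P = P → (∀ o i, V o i * P = P * V o i * P) → P = 0 ∨ P = 1) ∧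
  spectralRadius ℂ (transfer V V) = 1 ∧
  (1 : ℂ) ∈ spectrum ℂ (transfer V V) ∧
  ∀ z ∈ spectrum ℂ (transfer V V), ‖z‖ = 1 → z = 1

/-- The tensors `A j` form a basis of normal tensors for `V`. -/
def IsBNT {g : ℕ} {D : Fin g → ℕ} (A : (j : Fin g) → MPOTensor O I (Fin (D j)))
    (V : MPOTensor O I B) : Prop :=
  (∀ j, IsNormalTensor (A j)) ∧
  (∀ N : ℕ, 1 ≤ N → mpo V N ∈ Submodule.span ℂ (Set.range fun j => mpo (A j) N)) ∧
  ∃ N₀ : ℕ, ∀ N : ℕ, N₀ < N → LinearIndependent ℂ fun j => mpo (A j) N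

/-- The tensor `⊕_j (1_{m_j} ⊗ A_j)`. -/
def multiplicitySum {g : ℕ} {D : Fin g → ℕ} (m : Fin g → ℕ)
    (A : (j : Fin g) → MPOTensor O I (Fin (D j))) :
    MPOTensor O I (Σ j : Fin g, Fin (m j) × Fin (D j)) :=
  fun o i => Matrix.blockDiagonal' fun j => (1 : Matrix (Fin (m j)) (Fin (m j)) ℂ) ⊗ₖ A j o i

/-- After a change of basis of the bond space, `V` is block upper triangular, and its block
diagonal part is `W` together with zero blocks. -/
def BlockTriangularReduction (V : MPOTensor O I B) (W : MPOTensor O I B') : Prop :=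
  ∃ (n : ℕ) (e : B ≃ B' ⊕ Fin n) (X : (Matrix B B ℂ)ˣ) (b : B' ⊕ Fin n → ℕ), ∀ o i,
    (Matrix.reindex e e (X.val * V o i * X.inv)).BlockTriangular b ∧
    ∀ x y, Matrix.fromBlocks (W o i) 0 0 (0 : Matrix (Fin n) (Fin n) ℂ) x y =
      if b x = b y then Matrix.reindex e e (X.val * V o i * X.inv) x y else 0

end Tensors

/-- The data of a canonical form `⊕_j ⊕_{q = 1}^{m_j} μ_{j,q} A_j` with non-zero coefficients. -/
structure CanonicalData (O I : Type*) where
  /-- the number of distinct blocks -/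
  g : ℕ
  /-- the bond dimensions of the blocks -/
  D : Fin g → ℕ
  /-- the multiplicities of the blocks -/
  mult : Fin g → ℕ
  mult_pos : ∀ j, 0 < mult j
  /-- the coefficients `μ_{j,q}` -/
  coeff : (j : Fin g) → Fin (mult j) → ℂ
  coeff_ne_zero : ∀ j q, coeff j q ≠ 0
  /-- the blocks `A_j` -/
  block : (j : Fin g) → MPOTensor O I (Fin (D j))

namespace CanonicalData

variable {O I B : Type*} [Fintype O] [Fintype I] [Fintype B]
  [DecidableEq O] [DecidableEq I] [DecidableEq B]

/-- The tensor `⊕_j ⊕_q μ_{j,q} A_j`, written as `⊕_j (diag(μ_{j,1}, …, μ_{j,m_j}) ⊗ A_j)`. -/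
def tensor (C : CanonicalData O I) :
    MPOTensor O I (Σ j : Fin C.g, Fin (C.mult j) × Fin (C.D j)) :=
  fun o i => Matrix.blockDiagonal' fun j => Matrix.diagonal (C.coeff j) ⊗ₖ C.block j o i

/-- `C` is a canonical form of `V`: its blocks are a basis of normal tensors for `V`, and its
tensor generates the same operators as `V` on every number of sites. -/
def IsCanonicalFormOf (C : CanonicalData O I) (V : MPOTensor O I B) : Prop :=
  IsBNT C.block V ∧ ∀ N : ℕ, 1 ≤ N → mpo C.tensor N = mpo V N

end CanonicalData

end

/-! Only the trace of the isometry condition is needed. If the operators of `V` are sums of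
operators generated by tensors `W a`, their Hilbert–Schmidt inner products are traces of powers of
mixed transfer matrices, and the condition becomes ∑ tr E(W a, W a')^N = c for all N ≥ 1, summed
over all pairs. Power sums that do not depend on N leave no room for eigenvalues other than 0 and 1,
so each E(E - 1) is nilpotent (`GeneratesSMPI.isNilpotent`).

For irreducible blocks this spectral information replaces the analytic part of Perron–Frobenius
theory. If E(K, K) is not nilpotent, the map X ↦ ∑ K X K† and its adjoint have positive definite
fixed points. These turn every fixed point of a mixed map into an intertwiner
(`intertwines_of_fixed`), which by Schur's lemma is zero or invertible. Hence inequivalent blocks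
have a nilpotent mixed transfer matrix, while for a single block the eigenvalue 1 is simple and high
powers of the transfer matrix are projectors of rank one
(`IsNormalizedFamily.exists_mixedTransfer_pow`).

In a canonical form, μ_{j,q} A_j and μ_{j,q'} A_j have a mixed transfer matrix with the nonzero
eigenvalue μ_{j,q} conj(μ_{j,q'}). It must be 1, so the coefficients of one block are a common
phase. At large N the trace identity counts the pairs (q, q') belonging to the same j, which gives ∑
m_j² = c.

For existence, `V` is put in block triangular form with irreducible diagonal blocks. Only these
enter the traces, so the spectral argument applies to them: each is zero or already normalized, and
grouping the nonzero ones by similarity yields the canonical form. -/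

set_option linter.unusedSectionVars false

/-! ### Eigenvalues from traces of powers -/

section TracePowers

open Polynomial

/-- A matrix over a field of characteristic zero all of whose powers are traceless is nilpotent. -/
theorem Matrix.isNilpotent_of_trace_pow_eq_zero {n : Type*} [Fintype n] [DecidableEq n]
    (M : Matrix n n ℂ) (h : ∀ k : ℕ, 1 ≤ k → (M ^ k).trace = 0) : IsNilpotent M := by
  have htr : ∀ q : ℂ[X], (aeval M (X * q)).trace = 0 := by
    intro q
    induction q using Polynomial.induction_on' with
    | add p q hp hq => rw [mul_add, map_add, Matrix.trace_add, hp, hq, add_zero]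
    | monomial k a =>
      rw [X_mul_monomial, aeval_monomial, ← Algebra.smul_def, Matrix.trace_smul, h _ (by omega),
        smul_zero]
  obtain ⟨r, hr, hr0⟩ := exists_eq_pow_rootMultiplicity_mul_and_not_dvd M.charpoly
    M.charpoly_monic.ne_zero 0
  rw [C_0, sub_zero] at hr hr0
  set a := M.charpoly.rootMultiplicity 0
  -- The Bézout relation u X^(a+1) + v r = 1 splits off the projector onto the generalized
  -- eigenspaces of the nonzero eigenvalues. The exponent is a + 1, not a, so that this projector
  -- has no constant term as a polynomial in M even for a = 0. Its trace then vanishes, and the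
  -- trace of a projector is its rank.
  have hcop : IsCoprime (X ^ (a + 1)) r :=
    ((irreducible_X.coprime_iff_not_dvd).2 hr0).pow_left
  obtain ⟨u, v, huv⟩ := hcop
  have hCH : aeval M (X ^ a * r) = 0 := by rw [← hr]; exact M.aeval_self_charpoly
  have hidem : IsIdempotentElem (aeval M (u * X ^ (a + 1))) := by
    have h0 : aeval M (u * X ^ (a + 1)) * aeval M (v * r) = 0 := by
      rw [← map_mul, show u * X ^ (a + 1) * (v * r) = u * v * X * (X ^ a * r) by ring, map_mul, hCH,
        mul_zero]
    have h1 : aeval M (u * X ^ (a + 1)) + aeval M (v * r) = 1 := by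
      rw [← map_add, huv, map_one]
    calc aeval M (u * X ^ (a + 1)) * aeval M (u * X ^ (a + 1))
        = aeval M (u * X ^ (a + 1)) * (aeval M (u * X ^ (a + 1)) + aeval M (v * r)) := by
          rw [mul_add, h0, add_zero]
      _ = _ := by rw [h1, mul_one]
  have he : aeval M (u * X ^ (a + 1)) = 0 := by
    have ht := htr (u * X ^ a)
    rw [show X * (u * X ^ a) = u * X ^ (a + 1) by ring] at ht
    have hp : IsIdempotentElem (Matrix.toLin' (aeval M (u * X ^ (a + 1)))) := by
      have := congrArg Matrix.toLin' hidem
      rwa [Matrix.toLin'_mul] at this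
    have hpr := LinearMap.IsIdempotentElem.isProj_range _ hp
    have ht2 := hpr.trace
    rw [Matrix.trace_toLin'_eq, ht] at ht2
    have hb : LinearMap.range (Matrix.toLin' (aeval M (u * X ^ (a + 1)))) = ⊥ :=
      Submodule.finrank_eq_zero.1 (by exact_mod_cast ht2.symm)
    rw [LinearMap.range_eq_bot] at hb
    exact (LinearEquiv.map_eq_zero_iff _).1 hb
  refine ⟨a, ?_⟩
  have : X ^ a = X ^ a * (u * X ^ (a + 1)) + v * (X ^ a * r) := by
    linear_combination -(X ^ a) * huv
  have h2 := congrArg (aeval M) this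
  rw [map_add, map_mul (aeval M) (X ^ a), map_mul (aeval M) v, he, hCH] at h2
  simpa using h2

/-- If the traces of the powers of a family of matrices add up to a constant, then the matrices
have no eigenvalues besides `0` and `1`. -/
theorem Matrix.isNilpotent_mul_sub_one_of_sum_trace_pow {ι : Type*} [Fintype ι] [DecidableEq ι]
    {n : ι → Type*} [∀ t, Fintype (n t)] [∀ t, DecidableEq (n t)]
    (E : ∀ t, Matrix (n t) (n t) ℂ) (c : ℂ)
    (h : ∀ N : ℕ, 1 ≤ N → ∑ t, (E t ^ N).trace = c) (t : ι) : IsNilpotent (E t * (E t - 1)) := by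
  have key : ∀ q : ℂ[X], ∑ t, (aeval (E t) (X * q)).trace = c * q.eval 1 := by
    intro q
    induction q using Polynomial.induction_on' with
    | add p q hp hq =>
      simp only [mul_add, map_add, Matrix.trace_add, Finset.sum_add_distrib, hp, hq, eval_add]
    | monomial k a =>
      simp only [X_mul_monomial, aeval_monomial, ← Algebra.smul_def, Matrix.trace_smul,
        ← Finset.smul_sum]
      rw [h _ (by omega)]
      simp [mul_comm]
  -- X(X - 1) has no constant term and vanishes at 1, as do all its positive powers. By `key` the
  -- direct sum of the E(E - 1) therefore has only traceless powers.
  have hnil : IsNilpotent (Matrix.blockDiagonal' fun t => E t * (E t - 1)) := by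
    refine Matrix.isNilpotent_of_trace_pow_eq_zero _ fun k hk => ?_
    rw [← Matrix.blockDiagonal'_pow, Matrix.trace_blockDiagonal']
    obtain ⟨k, rfl⟩ : ∃ l, k = l + 1 := ⟨k - 1, by omega⟩
    have := key ((X - 1) * (X * (X - 1)) ^ k)
    rw [← mul_assoc, ← pow_succ'] at this
    simpa using this
  obtain ⟨k, hk⟩ := hnil
  refine ⟨k, ?_⟩
  rw [← Matrix.blockDiagonal'_pow, ← Matrix.blockDiagonal'_zero, Matrix.blockDiagonal'_inj] at hk
  exact congrFun hk t

end TracePowers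

/-! ### Kraus maps, words and irreducibility -/

section KrausFamilies

open scoped ComplexOrder Matrix

variable {S m n : Type*} [Fintype S] [Fintype m] [Fintype n] [DecidableEq m] [DecidableEq n]

/-- The mixed transfer matrix of two families of square matrices. -/
def mixedTransfer (K : S → Matrix m m ℂ) (L : S → Matrix n n ℂ) : Matrix (m × n) (m × n) ℂ :=
  ∑ s, K s ⊗ₖ (L s).map (starRingEnd ℂ)

/-- The map `X ↦ ∑ K X L†` whose matrix is the mixed transfer matrix. -/
def krausMap (K : S → Matrix m m ℂ) (L : S → Matrix n n ℂ) : Module.End ℂ (Matrix m n ℂ) where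
  toFun X := ∑ s, K s * X * (L s)ᴴ
  map_add' X Y := by simp [Matrix.mul_add, Matrix.add_mul, Finset.sum_add_distrib]
  map_smul' a X := by simp [Finset.smul_sum]

theorem krausMap_apply (K : S → Matrix m m ℂ) (L : S → Matrix n n ℂ) (X : Matrix m n ℂ) :
    krausMap K L X = ∑ s, K s * X * (L s)ᴴ := rfl

variable (m n) in
/-- Matrices on `m × n` act on `Matrix m n ℂ`. -/
def matrixActionEquiv : Matrix (m × n) (m × n) ℂ ≃ₐ[ℂ] Module.End ℂ (Matrix m n ℂ) :=
  Matrix.toLinAlgEquiv'.trans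
    (((LinearEquiv.curry ℂ ℂ m n).trans (Matrix.ofLinearEquiv ℂ)).conjAlgEquiv ℂ)

theorem matrixActionEquiv_apply (E : Matrix (m × n) (m × n) ℂ) (X : Matrix m n ℂ) (a : m) (b : n) :
    matrixActionEquiv m n E X a b = (E *ᵥ fun p => X p.1 p.2) (a, b) := rfl

theorem matrixActionEquiv_mixedTransfer (K : S → Matrix m m ℂ) (L : S → Matrix n n ℂ) :
    matrixActionEquiv m n (mixedTransfer K L) = krausMap K L := by
  ext X : 1
  ext a b
  rw [matrixActionEquiv_apply, krausMap_apply, Matrix.sum_apply, mixedTransfer, Matrix.sum_mulVec,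
    Finset.sum_apply]
  refine Finset.sum_congr rfl fun s _ => ?_
  simp only [Matrix.mulVec, dotProduct, Matrix.mul_apply, Fintype.sum_prod_type,
    Matrix.kroneckerMap_apply, Matrix.map_apply, Matrix.conjTranspose_apply, Finset.sum_mul]
  rw [Finset.sum_comm]
  refine Finset.sum_congr rfl fun x _ => Finset.sum_congr rfl fun y _ => ?_
  simp only [starRingEnd_apply]
  ring

theorem mixedTransfer_conjTranspose (K : S → Matrix m m ℂ) (L : S → Matrix n n ℂ) :
    mixedTransfer (fun s => (K s)ᴴ) (fun s => (L s)ᴴ) = (mixedTransfer K L)ᴴ := by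
  ext a b
  simp [mixedTransfer, Matrix.sum_apply, Matrix.conjTranspose_apply]

theorem krausMap_conjTranspose (K : S → Matrix m m ℂ) (L : S → Matrix n n ℂ) (X : Matrix m n ℂ) :
    (krausMap K L X)ᴴ = krausMap L K Xᴴ := by
  simp [krausMap_apply, Matrix.conjTranspose_sum, Matrix.mul_assoc]

theorem krausMap_posSemidef (K : S → Matrix n n ℂ) {X : Matrix n n ℂ} (hX : X.PosSemidef) :
    (krausMap K K X).PosSemidef :=
  Matrix.posSemidef_sum _ fun s _ => hX.mul_mul_conjTranspose_same (K s)

/-- The products of `N` members of a family. -/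
def wordProd (K : S → Matrix n n ℂ) (N : ℕ) : (Fin N → S) → Matrix n n ℂ :=
  fun w => (List.ofFn fun k => K (w k)).prod

theorem wordProd_cons (K : S → Matrix n n ℂ) (N : ℕ) (s : S) (w : Fin N → S) :
    wordProd K (N + 1) (Fin.cons s w) = K s * wordProd K N w := by
  simp [wordProd, List.ofFn_succ]

/-- The mixed-product rule for Kronecker products turns blocking into taking powers, so statements
about large N become statements about powers of one matrix. -/
theorem mixedTransfer_wordProd (K : S → Matrix m m ℂ) (L : S → Matrix n n ℂ) (N : ℕ) :
    mixedTransfer (wordProd K N) (wordProd L N) = mixedTransfer K L ^ N := by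
  induction N with
  | zero =>
    simp [mixedTransfer, wordProd, Matrix.map_one]
  | succ N ih =>
    rw [pow_succ', ← ih, mixedTransfer,
      ← (Fin.consEquiv fun _ : Fin (N + 1) => S).sum_comp, Fintype.sum_prod_type]
    simp only [mixedTransfer, Finset.sum_mul_sum]
    refine Finset.sum_congr rfl fun s _ => Finset.sum_congr rfl fun w _ => ?_
    rw [← Matrix.mul_kronecker_mul, ← Matrix.map_mul, ← wordProd_cons, ← wordProd_cons]
    rfl

/-- A family of matrices is irreducible if it has no non-trivial invariant projector. -/
def IsIrreducibleFamily (K : S → Matrix n n ℂ) : Prop :=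
  ∀ P : Matrix n n ℂ, P * P = P → (∀ s, K s * P = P * K s * P) → P = 0 ∨ P = 1

/-- If the range of P is invariant under the adjoints, the kernel of P† is invariant under the
family, and 1 - P† projects onto it. -/
theorem IsIrreducibleFamily.conjTranspose {K : S → Matrix n n ℂ} (h : IsIrreducibleFamily K) :
    IsIrreducibleFamily fun s => (K s)ᴴ := by
  intro P hP hK
  have := h (1 - Pᴴ) (by
    have := congrArg Matrix.conjTranspose hP
    rw [Matrix.conjTranspose_mul] at this
    rw [mul_sub, mul_one, sub_mul, one_mul, this, sub_self, sub_zero]) (fun s => by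
    have := congrArg Matrix.conjTranspose (hK s)
    simp only [Matrix.conjTranspose_mul, Matrix.conjTranspose_conjTranspose] at this
    rw [← mul_assoc] at this
    simp only [mul_sub, sub_mul, mul_one, one_mul]
    rw [← this]
    abel)
  rcases this with h | h
  · right
    simpa using congrArg Matrix.conjTranspose (sub_eq_zero.1 h).symm
  · left
    simpa using congrArg Matrix.conjTranspose h

/-- Projectors need not be orthogonal here: the projection onto an invariant subspace along any
complement is an invariant projector. -/
theorem IsIrreducibleFamily.submodule_eq {K : S → Matrix n n ℂ} (h : IsIrreducibleFamily K)
    (W : Submodule ℂ (n → ℂ)) (hW : ∀ s, ∀ v ∈ W, K s *ᵥ v ∈ W) : W = ⊥ ∨ W = ⊤ := by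
  obtain ⟨W', hc⟩ := W.exists_isCompl
  set p := W.projection W' hc with hp
  have hidem : p * p = p := W.isIdempotentElem_projection hc
  have hmul : ∀ q r : Module.End ℂ (n → ℂ), LinearMap.toMatrix' (q * r) =
    LinearMap.toMatrix' q * LinearMap.toMatrix' r := fun q r => LinearMap.toMatrix'_mul q r
  have hr : LinearMap.range p = W := W.range_projection hc
  rcases h (LinearMap.toMatrix' p) (by rw [← hmul, hidem]) (fun s => by
    have : K s = LinearMap.toMatrix' (Matrix.toLin' (K s)) := by simp
    rw [this, ← hmul, ← hmul, ← hmul]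
    congr 1
    refine LinearMap.ext fun v => ?_
    simp only [Module.End.mul_apply]
    refine ((W.projection_eq_self_iff hc _).2 ?_).symm
    rw [Matrix.toLin'_apply]
    exact hW s _ (W.projection_apply_mem hc _)) with h0 | h1
  · left
    rw [← hr, LinearMap.range_eq_bot]
    simpa using h0
  · right
    rw [← hr, LinearMap.range_eq_top]
    have : p = LinearMap.id := by
      apply LinearMap.toMatrix'.injective
      rw [h1, LinearMap.toMatrix'_id]
    rw [this]
    exact Function.surjective_id

end KrausFamilies

/-! ### Positive fixed points of Kraus maps -/

section FixedPoints

open scoped ComplexOrder Matrix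

/-- If `T` only has the eigenvalues `0` and `1`, every vector that no power of `T` annihilates
leads to an eigenvector for the eigenvalue `1`. -/
theorem Module.End.exists_iterate_sub_one_eq_zero {E : Type*} [AddCommGroup E] [Module ℂ E]
    {T : Module.End ℂ E} {a : ℕ} (h : (T * (T - 1)) ^ a = 0) {y : E} (hy : (T ^ a) y ≠ 0) :
    ∃ k : ℕ, ((T - 1) ^ k : Module.End ℂ E) ((T ^ a) y) ≠ 0 ∧
      ((T - 1) ^ (k + 1) : Module.End ℂ E) ((T ^ a) y) = 0 := by
  classical
  have hc : Commute T (T - 1) := (Commute.refl T).sub_right (Commute.one_right T)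
  have hex : ∃ k : ℕ, ((T - 1) ^ k : Module.End ℂ E) ((T ^ a) y) = 0 := by
    refine ⟨a, ?_⟩
    rw [← Module.End.mul_apply, ← ((hc.pow_pow a a).eq), ← hc.mul_pow, h, LinearMap.zero_apply]
  have hpos : Nat.find hex ≠ 0 := by
    intro h0
    have := Nat.find_spec hex
    rw [h0] at this
    exact hy (by simpa using this)
  obtain ⟨k, hk⟩ := Nat.exists_eq_succ_of_ne_zero hpos
  refine ⟨k, Nat.find_min hex (by omega), ?_⟩
  have := Nat.find_spec hex
  rwa [hk] at this

theorem Module.End.exists_fixed_of_not_isNilpotent {E : Type*} [AddCommGroup E] [Module ℂ E]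
    {T : Module.End ℂ E} (h : IsNilpotent (T * (T - 1))) (hT : ¬ IsNilpotent T) :
    ∃ x, x ≠ 0 ∧ T x = x := by
  obtain ⟨a, ha⟩ := h
  obtain ⟨y, hy⟩ : ∃ y, (T ^ a) y ≠ 0 := by
    by_contra! hcon
    exact hT ⟨a, LinearMap.ext hcon⟩
  obtain ⟨k, hk, hk'⟩ := Module.End.exists_iterate_sub_one_eq_zero ha hy
  refine ⟨_, hk, ?_⟩
  rw [pow_succ', Module.End.mul_apply, LinearMap.sub_apply, Module.End.one_apply] at hk'
  exact sub_eq_zero.1 hk'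

/-- A real sequence with uniformly negative increments eventually is uniformly negative. -/
theorem eventually_le_neg_of_increments {f : ℕ → ℝ}
    (h : ∃ ε > 0, ∃ n₀, ∀ n ≥ n₀, f (n + 1) - f n ≤ -ε) : ∃ ε > 0, ∃ n₀, ∀ n ≥ n₀, f n ≤ -ε := by
  obtain ⟨ε, hε, n₀, hn⟩ := h
  have key : ∀ k : ℕ, f (n₀ + k) ≤ f n₀ - k * ε := by
    intro k
    induction k with
    | zero => simp
    | succ k ih =>
      have := hn (n₀ + k) (by omega)
      push_cast
      rw [← add_assoc]
      linarith
  obtain ⟨M, hM⟩ := exists_nat_gt ((f n₀ + 1) / ε)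
  refine ⟨1, one_pos, n₀ + M, fun n hn' => ?_⟩
  obtain ⟨k, rfl⟩ := Nat.exists_eq_add_of_le (le_trans (Nat.le_add_right n₀ M) hn')
  have h1 := key k
  have h2 : (M : ℝ) ≤ k := by exact_mod_cast (by omega : M ≤ k)
  rw [div_lt_iff₀ hε] at hM
  have := mul_le_mul_of_nonneg_right h2 hε.le
  linarith

variable {S m n : Type*} [Fintype S] [Fintype m] [Fintype n] [DecidableEq m] [DecidableEq n]

theorem Matrix.PosSemidef.krausMap_pow {K : S → Matrix n n ℂ} {y : Matrix n n ℂ}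
    (hy : y.PosSemidef) (N : ℕ) : ((krausMap K K ^ N) y).PosSemidef := by
  induction N with
  | zero => simpa using hy
  | succ N ih =>
    rw [pow_succ', Module.End.mul_apply]
    exact krausMap_posSemidef K ih

/-- The leading coefficient of the polynomially growing sequence `Φ ^ N y` is positive. -/
theorem posSemidef_leading_term (K : S → Matrix n n ℂ) {y : Matrix n n ℂ} (hy : y.PosSemidef)
    (k : ℕ) (hk : ((krausMap K K - 1) ^ (k + 1)) y = 0) :
    (((krausMap K K - 1) ^ k) y).PosSemidef := by
  set T := krausMap K K with hT
  have hherm : ∀ j : ℕ, (((T - 1) ^ j : Module.End ℂ (Matrix n n ℂ)) y).IsHermitian := by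
    intro j
    induction j with
    | zero => simpa using hy.1
    | succ j ih =>
      rw [pow_succ', Module.End.mul_apply, LinearMap.sub_apply, Module.End.one_apply]
      refine Matrix.IsHermitian.sub ?_ ih
      rw [Matrix.IsHermitian, hT, krausMap_conjTranspose, ih.eq]
  refine Matrix.PosSemidef.of_dotProduct_mulVec_nonneg (hherm k) fun u => ?_
  rw [Complex.nonneg_iff]
  refine ⟨?_, by simpa using ((hherm k).im_star_dotProduct_mulVec_self u).symm⟩
  by_contra! hneg
  -- Discrete integration: the increments of f j are f (j + 1), and f k is constant. If that
  -- constant were negative, then f (k - 1), ..., f 0 would in turn be eventually uniformly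
  -- negative. But f 0 N is the expectation of T^N y, which is nonnegative.
  let f : ℕ → ℕ → ℝ := fun j N => (star u ⬝ᵥ (((T - 1) ^ j) ((T ^ N) y)) *ᵥ u).re
  have hc : Commute (T - 1) T := ((Commute.refl T).sub_left (Commute.one_left T))
  have hstep : ∀ j N, f j (N + 1) - f j N = f (j + 1) N := by
    intro j N
    have h1 : ((T - 1) ^ (j + 1)) ((T ^ N) y) =
        ((T - 1) ^ j) ((T ^ (N + 1)) y) - ((T - 1) ^ j) ((T ^ N) y) := by
      rw [pow_succ, Module.End.mul_apply, LinearMap.sub_apply, Module.End.one_apply, map_sub,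
        ← Module.End.mul_apply T, ← pow_succ']
    simp only [f]
    rw [h1, Matrix.sub_mulVec, dotProduct_sub, Complex.sub_re]
  have hconst : ∀ N, f k N = f k 0 := by
    intro N
    induction N with
    | zero => rfl
    | succ N ih =>
      have h0 : f (k + 1) N = 0 := by
        simp only [f]
        rw [← Module.End.mul_apply, (hc.pow_pow (k + 1) N).eq, Module.End.mul_apply, hk]
        simp
      linarith [hstep k N]
  have hdesc : ∀ i ≤ k, ∃ ε > 0, ∃ n₀, ∀ N ≥ n₀, f (k - i) N ≤ -ε := by
    intro i
    induction i with
    | zero =>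
      intro _
      refine ⟨-f k 0, ?_, 0, fun N _ => ?_⟩
      · simpa [f] using hneg
      · simp [hconst N]
    | succ i ih =>
      intro hi
      apply eventually_le_neg_of_increments
      obtain ⟨ε, hε, n₀, h⟩ := ih (by omega)
      refine ⟨ε, hε, n₀, fun N hN => ?_⟩
      rw [hstep, show k - (i + 1) + 1 = k - i by omega]
      exact h N hN
  obtain ⟨ε, hε, n₀, h⟩ := hdesc k le_rfl
  have h1 := h n₀ le_rfl
  have h2 := ((hy.krausMap_pow (K := K) n₀).dotProduct_mulVec_nonneg u)
  rw [Complex.nonneg_iff] at h2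
  have h3 : f (k - k) n₀ = (star u ⬝ᵥ ((T ^ n₀) y) *ᵥ u).re := by simp [f]
  linarith [h2.1]

theorem matrixActionEquiv_isNilpotent {E : Matrix (m × n) (m × n) ℂ} :
    IsNilpotent (matrixActionEquiv m n E) ↔ IsNilpotent E :=
  IsNilpotent.map_iff (matrixActionEquiv m n).injective

theorem Matrix.sum_mul_conjTranspose_eq_zero {K : S → Matrix n m ℂ}
    (h : ∑ s, K s * (K s)ᴴ = 0) (s : S) : K s = 0 := by
  have h1 : ∑ s, (K s * (K s)ᴴ).trace = 0 := by rw [← Matrix.trace_sum, h, Matrix.trace_zero]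
  rw [Finset.sum_eq_zero_iff_of_nonneg
    fun s _ => (Matrix.posSemidef_self_mul_conjTranspose (K s)).trace_nonneg] at h1
  exact Matrix.trace_mul_conjTranspose_self_eq_zero_iff.1 (h1 s (Finset.mem_univ s))

/-- T^N(1) is the sum of w w† over all words w of length N, and a vanishing sum of positive matrices
has vanishing terms. -/
theorem wordProd_eq_zero_of_krausMap_pow_one {K : S → Matrix n n ℂ} {N : ℕ}
    (h : (krausMap K K ^ N) 1 = 0) (w : Fin N → S) : wordProd K N w = 0 := by
  refine Matrix.sum_mul_conjTranspose_eq_zero (K := wordProd K N) ?_ w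
  rw [← matrixActionEquiv_mixedTransfer, ← map_pow, ← mixedTransfer_wordProd,
    matrixActionEquiv_mixedTransfer, krausMap_apply] at h
  simpa using h

theorem isNilpotent_of_krausMap_pow_one {K : S → Matrix n n ℂ} {N : ℕ}
    (h : (krausMap K K ^ N) 1 = 0) : IsNilpotent (mixedTransfer K K) := by
  refine ⟨N, ?_⟩
  rw [← mixedTransfer_wordProd, mixedTransfer]
  refine Finset.sum_eq_zero fun w _ => ?_
  rw [wordProd_eq_zero_of_krausMap_pow_one h w, Matrix.zero_kronecker]

/-- A Kraus map with eigenvalues `0` and `1` has a positive fixed point. -/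
theorem exists_posSemidef_fixed {K : S → Matrix n n ℂ}
    (h : IsNilpotent (mixedTransfer K K * (mixedTransfer K K - 1)))
    (hK : ¬ IsNilpotent (mixedTransfer K K)) :
    ∃ ρ : Matrix n n ℂ, ρ.PosSemidef ∧ ρ ≠ 0 ∧ krausMap K K ρ = ρ := by
  obtain ⟨a, ha⟩ := h
  have ha' : (krausMap K K * (krausMap K K - 1)) ^ a = 0 := by
    have := congrArg (matrixActionEquiv n n) ha
    simpa only [map_pow, map_mul, map_sub, map_one, map_zero, matrixActionEquiv_mixedTransfer]
      using this
  -- Starting from the identity makes the vector positive and also nonzero after a steps. The factor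
  -- T^a removes the nilpotent part, so only the generalized eigenspace of 1 remains, and the last
  -- nonzero (T - 1)^k T^a(1) is both fixed and positive.
  have hy : (krausMap K K ^ a) 1 ≠ 0 := fun h0 => hK (isNilpotent_of_krausMap_pow_one h0)
  obtain ⟨k, hk, hk'⟩ := Module.End.exists_iterate_sub_one_eq_zero ha' hy
  refine ⟨_, posSemidef_leading_term K (Matrix.PosSemidef.one.krausMap_pow a) k hk', hk, ?_⟩
  rw [pow_succ', Module.End.mul_apply, LinearMap.sub_apply, Module.End.one_apply] at hk'
  exact sub_eq_zero.1 hk'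

theorem Matrix.PosSemidef.mulVec_eq_zero {X : Matrix n n ℂ} (hX : X.PosSemidef) {v : n → ℂ}
    (h : star v ⬝ᵥ X *ᵥ v = 0) : X *ᵥ v = 0 :=
  (hX.dotProduct_mulVec_zero_iff v).1 h

/-- A positive fixed point of an irreducible Kraus map has full rank. -/
theorem IsIrreducibleFamily.posDef_of_fixed {K : S → Matrix n n ℂ} (hirr : IsIrreducibleFamily K)
    {ρ : Matrix n n ℂ} (hρ : ρ.PosSemidef) (h0 : ρ ≠ 0) (hfix : krausMap K K ρ = ρ) :
    ρ.PosDef := by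
  -- For v in the kernel, 0 = v†ρv = ∑ (K†v)†ρ(K†v) with nonnegative terms, so each K†v is in the
  -- kernel too. Irreducibility of the adjoints leaves only the trivial kernel.
  have hinv : ∀ s, ∀ v ∈ LinearMap.ker ρ.mulVecLin, (K s)ᴴ *ᵥ v ∈ LinearMap.ker ρ.mulVecLin := by
    intro s v hv
    rw [LinearMap.mem_ker, Matrix.mulVecLin_apply] at hv ⊢
    have h1 : ∑ s, star ((K s)ᴴ *ᵥ v) ⬝ᵥ ρ *ᵥ ((K s)ᴴ *ᵥ v) = 0 := by
      have h2 : star v ⬝ᵥ (krausMap K K ρ) *ᵥ v = 0 := by rw [hfix, hv, dotProduct_zero]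
      rw [krausMap_apply, Matrix.sum_mulVec, dotProduct_sum] at h2
      rw [← h2]
      refine Finset.sum_congr rfl fun s _ => ?_
      rw [Matrix.star_mulVec, Matrix.conjTranspose_conjTranspose, ← Matrix.dotProduct_mulVec,
        Matrix.mulVec_mulVec, Matrix.mulVec_mulVec]
    rw [Finset.sum_eq_zero_iff_of_nonneg fun s _ => hρ.dotProduct_mulVec_nonneg _] at h1
    exact hρ.mulVec_eq_zero (h1 s (Finset.mem_univ s))
  rcases hirr.conjTranspose.submodule_eq _ hinv with hb | ht
  · refine Matrix.PosDef.of_dotProduct_mulVec_pos hρ.1 fun v hv => ?_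
    refine lt_of_le_of_ne (hρ.dotProduct_mulVec_nonneg v) fun h => hv ?_
    have : v ∈ LinearMap.ker ρ.mulVecLin := hρ.mulVec_eq_zero h.symm
    rwa [hb, Submodule.mem_bot] at this
  · refine (h0 ?_).elim
    rw [LinearMap.ker_eq_top] at ht
    exact Matrix.ext_of_mulVec_single fun i => by
      have := LinearMap.congr_fun ht (Pi.single i 1)
      rw [Matrix.zero_mulVec]
      exact this

theorem IsIrreducibleFamily.exists_posDef_fixed {K : S → Matrix n n ℂ}
    (hirr : IsIrreducibleFamily K)
    (h : IsNilpotent (mixedTransfer K K * (mixedTransfer K K - 1)))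
    (hK : ¬ IsNilpotent (mixedTransfer K K)) :
    ∃ ρ : Matrix n n ℂ, ρ.PosDef ∧ krausMap K K ρ = ρ := by
  obtain ⟨ρ, h1, h2, h3⟩ := exists_posSemidef_fixed h hK
  exact ⟨ρ, hirr.posDef_of_fixed h1 h2 h3, h3⟩

theorem IsIrreducibleFamily.exists_posDef_fixed_adjoint {K : S → Matrix n n ℂ}
    (hirr : IsIrreducibleFamily K)
    (h : IsNilpotent (mixedTransfer K K * (mixedTransfer K K - 1)))
    (hK : ¬ IsNilpotent (mixedTransfer K K)) :
    ∃ σ : Matrix n n ℂ, σ.PosDef ∧ ∑ s, (K s)ᴴ * σ * K s = σ := by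
  have hs : ∀ M : Matrix (n × n) (n × n) ℂ, IsNilpotent M → IsNilpotent Mᴴ := by
    rintro M ⟨k, hk⟩
    exact ⟨k, by rw [← Matrix.conjTranspose_pow, hk, Matrix.conjTranspose_zero]⟩
  obtain ⟨σ, h1, h2⟩ := hirr.conjTranspose.exists_posDef_fixed
    (by
      rw [mixedTransfer_conjTranspose]
      have := hs _ h
      rw [Matrix.conjTranspose_mul, Matrix.conjTranspose_sub, Matrix.conjTranspose_one] at this
      simpa [mul_sub, sub_mul] using this)
    (by
      rw [mixedTransfer_conjTranspose]
      exact fun h' => hK (by simpa using hs _ h'))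
  exact ⟨σ, h1, by simpa [krausMap_apply] using h2⟩

end FixedPoints

/-! ### Intertwiners, Schur's lemma and the peripheral spectrum -/

section Intertwiners

open scoped ComplexOrder Matrix

variable {S m n : Type*} [Fintype S] [Fintype m] [Fintype n] [DecidableEq m] [DecidableEq n]

open scoped MatrixOrder in
theorem Matrix.PosSemidef.exists_eq_mul_conjTranspose {A : Matrix n n ℂ} (hA : A.PosSemidef) :
    ∃ B : Matrix n n ℂ, A = B * Bᴴ := by
  obtain ⟨B, rfl⟩ := CStarAlgebra.nonneg_iff_eq_star_mul_self.mp hA.nonneg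
  exact ⟨star B, by rw [← Matrix.star_eq_conjTranspose, star_star]⟩

theorem Matrix.PosDef.eq_zero_of_trace {σ : Matrix n n ℂ} (hσ : σ.PosDef) {C : Matrix n m ℂ}
    (h : (Cᴴ * σ * C).trace = 0) : C = 0 := by
  rw [(hσ.posSemidef.conjTranspose_mul_mul_same C).trace_eq_zero_iff] at h
  refine Matrix.ext_of_mulVec_single fun i => ?_
  rw [Matrix.zero_mulVec]
  by_contra hne
  have := hσ.dotProduct_mulVec_pos hne
  rw [Matrix.star_mulVec, ← Matrix.dotProduct_mulVec, Matrix.mulVec_mulVec, Matrix.mulVec_mulVec,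
    h, Matrix.zero_mulVec, dotProduct_zero] at this
  exact lt_irrefl _ this

theorem Matrix.PosDef.eq_zero_of_conj {ρ : Matrix n n ℂ} (hρ : ρ.PosDef) {A : Matrix m n ℂ}
    (h : A * ρ * Aᴴ = 0) : A = 0 := by
  have : (Aᴴᴴ * ρ * Aᴴ).trace = 0 := by
    rw [Matrix.conjTranspose_conjTranspose, h, Matrix.trace_zero]
  simpa using hρ.eq_zero_of_trace this

/-- Fixed points of a mixed Kraus map are intertwiners, up to a fixed point of the second map. -/
theorem intertwines_of_fixed {K : S → Matrix m m ℂ} {L : S → Matrix n n ℂ}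
    {σ : Matrix m m ℂ} (hσ : σ.PosDef) (hσK : ∑ s, (K s)ᴴ * σ * K s = σ)
    {ρ : Matrix n n ℂ} (hρ : ρ.PosDef) (hρL : krausMap L L ρ = ρ)
    {Y : Matrix m n ℂ} (hY : krausMap K L (Y * ρ) = Y * ρ) (s : S) : K s * Y = Y * L s := by
  obtain ⟨Q, hQ⟩ := hρ.posSemidef.exists_eq_mul_conjTranspose
  set Z := Y * ρ * Yᴴ with hZ
  have hY' : krausMap L K (ρ * Yᴴ) = ρ * Yᴴ := by
    have := congrArg Matrix.conjTranspose hY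
    rwa [krausMap_conjTranspose, Matrix.conjTranspose_mul, hρ.1.eq] at this
  -- Weighted sum of the squared defects of the intertwining relation. Each of the two cross terms
  -- and the term ∑ Y L ρ L† Y† reduces to Z by the fixed-point equations, leaving T(Z) - Z.
  have hsum : ∑ s, (K s * Y - Y * L s) * ρ * (K s * Y - Y * L s)ᴴ = krausMap K K Z - Z := by
    have h1 : ∑ s, K s * Y * ρ * (L s)ᴴ * Yᴴ = Z := by
      rw [← Matrix.sum_mul, hZ]
      congr 1
      simpa [krausMap_apply, Matrix.mul_assoc] using hY
    have h2 : ∑ s, Y * (L s * ρ * Yᴴ * (K s)ᴴ) = Z := by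
      rw [← Matrix.mul_sum, hZ, Matrix.mul_assoc Y]
      congr 1
      simpa [krausMap_apply, Matrix.mul_assoc] using hY'
    have h3 : ∑ s, Y * (L s * ρ * (L s)ᴴ) * Yᴴ = Z := by
      rw [← Matrix.sum_mul, ← Matrix.mul_sum, ← krausMap_apply, hρL]
    have h4 : krausMap K K Z - Z = krausMap K K Z - ∑ s, K s * Y * ρ * (L s)ᴴ * Yᴴ -
        ∑ s, Y * (L s * ρ * Yᴴ * (K s)ᴴ) + ∑ s, Y * (L s * ρ * (L s)ᴴ) * Yᴴ := by
      rw [h1, h2, h3]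
      abel
    rw [h4, krausMap_apply, ← Finset.sum_sub_distrib, ← Finset.sum_sub_distrib,
      ← Finset.sum_add_distrib]
    refine Finset.sum_congr rfl fun s _ => ?_
    simp only [Matrix.conjTranspose_sub, Matrix.conjTranspose_mul, Matrix.sub_mul, Matrix.mul_sub,
      Matrix.mul_assoc, hZ]
    abel
  -- Pairing with σ, which is fixed by the adjoint map, annihilates T(Z) - Z. The defects thus give
  -- a vanishing sum of nonnegative traces; positive definiteness of σ and ρ removes the weights.
  have htr : ∑ s, (((K s * Y - Y * L s) * Q)ᴴ * σ * ((K s * Y - Y * L s) * Q)).trace = 0 := by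
    have h1 : (σ * krausMap K K Z).trace = (σ * Z).trace := by
      conv_rhs => rw [← hσK]
      rw [krausMap_apply, Matrix.mul_sum, Matrix.sum_mul, Matrix.trace_sum, Matrix.trace_sum]
      refine Finset.sum_congr rfl fun s _ => ?_
      rw [← Matrix.mul_assoc, Matrix.trace_mul_comm]
      simp only [Matrix.mul_assoc]
    have h2 : (σ * (krausMap K K Z - Z)).trace = 0 := by
      rw [Matrix.mul_sub, Matrix.trace_sub, h1, sub_self]
    rw [← hsum, Matrix.mul_sum, Matrix.trace_sum] at h2
    rw [← h2]
    refine Finset.sum_congr rfl fun s _ => ?_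
    rw [Matrix.mul_assoc, Matrix.trace_mul_comm, hQ, Matrix.conjTranspose_mul]
    simp only [Matrix.mul_assoc]
  rw [Finset.sum_eq_zero_iff_of_nonneg
    fun s _ => (hσ.posSemidef.conjTranspose_mul_mul_same _).trace_nonneg] at htr
  have h1 := hσ.eq_zero_of_trace (htr s (Finset.mem_univ s))
  refine sub_eq_zero.1 (hρ.eq_zero_of_conj ?_)
  rw [hQ, ← Matrix.mul_assoc, h1, Matrix.zero_mul, Matrix.zero_mul]

/-- Schur's lemma: non-zero intertwiners of irreducible families are invertible. -/
theorem IsIrreducibleFamily.intertwiner_invertible {K : S → Matrix m m ℂ} {L : S → Matrix n n ℂ}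
    (hK : IsIrreducibleFamily K) (hL : IsIrreducibleFamily L) {Y : Matrix m n ℂ}
    (hY : ∀ s, K s * Y = Y * L s) (h0 : Y ≠ 0) : ∃ Y' : Matrix n m ℂ, Y * Y' = 1 ∧ Y' * Y = 1 := by
  have hY0 : Y.mulVecLin ≠ 0 := by
    intro h
    refine h0 (Matrix.ext_of_mulVec_single fun i => ?_)
    rw [Matrix.zero_mulVec]
    exact LinearMap.congr_fun h (Pi.single i 1)
  have hker : LinearMap.ker Y.mulVecLin = ⊥ := by
    refine (hL.submodule_eq _ fun s v hv => ?_).resolve_right fun h => hY0 (LinearMap.ker_eq_top.1 h)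
    rw [LinearMap.mem_ker, Matrix.mulVecLin_apply] at hv ⊢
    rw [Matrix.mulVec_mulVec, ← hY, ← Matrix.mulVec_mulVec, hv, Matrix.mulVec_zero]
  have hran : LinearMap.range Y.mulVecLin = ⊤ := by
    refine (hK.submodule_eq _ fun s v hv => ?_).resolve_left fun h => hY0 (LinearMap.range_eq_bot.1 h)
    obtain ⟨u, rfl⟩ := hv
    refine ⟨L s *ᵥ u, ?_⟩
    simp only [Matrix.mulVecLin_apply, Matrix.mulVec_mulVec, hY]
  let e := LinearEquiv.ofBijective Y.mulVecLin
    ⟨LinearMap.ker_eq_bot.1 hker, LinearMap.range_eq_top.1 hran⟩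
  have hYe : Y = LinearMap.toMatrix' (e : (n → ℂ) →ₗ[ℂ] (m → ℂ)) := by
    have : (e : (n → ℂ) →ₗ[ℂ] (m → ℂ)) = Matrix.toLin' Y := rfl
    rw [this, LinearMap.toMatrix'_toLin']
  refine ⟨LinearMap.toMatrix' (e.symm : (m → ℂ) →ₗ[ℂ] (n → ℂ)), ?_, ?_⟩
  · rw [hYe, ← LinearMap.toMatrix'_comp, LinearEquiv.comp_symm, LinearMap.toMatrix'_id]
  · rw [hYe, ← LinearMap.toMatrix'_comp, LinearEquiv.symm_comp, LinearMap.toMatrix'_id]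

/-- For an eigenvalue z of Y, the intertwiner Y - z is not injective, so Schur's lemma forces it to
vanish. -/
theorem IsIrreducibleFamily.commutant_scalar {K : S → Matrix n n ℂ} (hK : IsIrreducibleFamily K)
    {Y : Matrix n n ℂ} (hY : ∀ s, K s * Y = Y * K s) : ∃ z : ℂ, Y = z • 1 := by
  cases isEmpty_or_nonempty n
  · exact ⟨0, Subsingleton.elim _ _⟩
  obtain ⟨z, hz⟩ := Module.End.exists_eigenvalue (Matrix.toLin' Y)
  obtain ⟨v, hv⟩ := hz.exists_hasEigenvector
  refine ⟨z, sub_eq_zero.1 ?_⟩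
  by_contra hne
  obtain ⟨Y', -, h⟩ := hK.intertwiner_invertible hK (Y := Y - z • 1)
    (fun s => by simp [mul_sub, sub_mul, hY]) hne
  have hv1 := hv.apply_eq_smul
  rw [Matrix.toLin'_apply] at hv1
  have : (Y - z • 1) *ᵥ v = 0 := by
    rw [Matrix.sub_mulVec, hv1, Matrix.smul_mulVec, Matrix.one_mulVec, sub_self]
  refine hv.2 ?_
  rw [← Matrix.one_mulVec v, ← h, ← Matrix.mulVec_mulVec, this, Matrix.mulVec_zero]

/-- Families with an invertible intertwiner. -/
def AreSimilar (K : S → Matrix m m ℂ) (L : S → Matrix n n ℂ) : Prop :=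
  ∃ (Y : Matrix m n ℂ) (Y' : Matrix n m ℂ), Y * Y' = 1 ∧ Y' * Y = 1 ∧ ∀ s, K s * Y = Y * L s

/-- An irreducible family, normalized in such a way that its transfer matrix has the eigenvalue `1`
and no further eigenvalues besides `0`. -/
structure IsNormalizedFamily (K : S → Matrix n n ℂ) : Prop where
  irreducible : IsIrreducibleFamily K
  nilpotent : IsNilpotent (mixedTransfer K K * (mixedTransfer K K - 1))
  not_nilpotent : ¬ IsNilpotent (mixedTransfer K K)

theorem krausMap_of_nilpotent {K : S → Matrix m m ℂ} {L : S → Matrix n n ℂ}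
    (h : IsNilpotent (mixedTransfer K L * (mixedTransfer K L - 1))) :
    IsNilpotent (krausMap K L * (krausMap K L - 1)) := by
  rw [← matrixActionEquiv_isNilpotent] at h
  simpa only [map_mul, map_sub, map_one, matrixActionEquiv_mixedTransfer] using h

/-- Inequivalent normalized families have a nilpotent mixed transfer matrix. -/
theorem IsNormalizedFamily.isNilpotent_or_similar {K : S → Matrix m m ℂ} {L : S → Matrix n n ℂ}
    (hK : IsNormalizedFamily K) (hL : IsNormalizedFamily L)
    (h : IsNilpotent (mixedTransfer K L * (mixedTransfer K L - 1))) :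
    IsNilpotent (mixedTransfer K L) ∨ AreSimilar K L := by
  by_cases hnil : IsNilpotent (mixedTransfer K L)
  · exact Or.inl hnil
  right
  obtain ⟨X, hX0, hX⟩ := Module.End.exists_fixed_of_not_isNilpotent (krausMap_of_nilpotent h)
    (by rwa [← matrixActionEquiv_mixedTransfer, matrixActionEquiv_isNilpotent])
  obtain ⟨ρ, hρ, hρL⟩ := hL.irreducible.exists_posDef_fixed hL.nilpotent hL.not_nilpotent
  obtain ⟨σ, hσ, hσK⟩ := hK.irreducible.exists_posDef_fixed_adjoint hK.nilpotent hK.not_nilpotent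
  -- Every fixed point of the mixed map has the form Y ρ because ρ is invertible, and Y is then the
  -- required intertwiner.
  have hXY : X = X * ρ⁻¹ * ρ := by
    rw [Matrix.mul_assoc, Matrix.nonsing_inv_mul _ ((Matrix.isUnit_iff_isUnit_det _).1 hρ.isUnit),
      Matrix.mul_one]
  have hY := intertwines_of_fixed hσ hσK hρ hρL (Y := X * ρ⁻¹) (by rw [← hXY, hX])
  obtain ⟨Y', h1, h2⟩ := hK.irreducible.intertwiner_invertible hL.irreducible hY (by
    intro h0
    rw [h0, Matrix.zero_mul] at hXY
    exact hX0 hXY)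
  exact ⟨_, Y', h1, h2, hY⟩

/-- High powers of the Kraus map of a normalized family have rank one. -/
theorem IsNormalizedFamily.exists_krausMap_pow {K : S → Matrix n n ℂ} (hK : IsNormalizedFamily K) :
    ∃ (ρ σ : Matrix n n ℂ) (a : ℕ), ρ.PosDef ∧ σ.PosDef ∧ (σ * ρ).trace = 1 ∧
      ∀ N ≥ a, ∀ X, (krausMap K K ^ N) X = (σ * X).trace • ρ := by
  obtain ⟨ρ, hρ, hρK⟩ := hK.irreducible.exists_posDef_fixed hK.nilpotent hK.not_nilpotent
  obtain ⟨σ, hσ, hσK⟩ := hK.irreducible.exists_posDef_fixed_adjoint hK.nilpotent hK.not_nilpotent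
  have hnonempty : Nonempty n := by
    by_contra hempty
    rw [not_nonempty_iff] at hempty
    exact hK.not_nilpotent ⟨1, Subsingleton.elim _ _⟩
  obtain ⟨Q, hQ⟩ := hρ.posSemidef.exists_eq_mul_conjTranspose
  have hnonneg : 0 ≤ (σ * ρ).trace := by
    rw [hQ, ← Matrix.mul_assoc, Matrix.trace_mul_comm, ← Matrix.mul_assoc]
    exact (hσ.posSemidef.conjTranspose_mul_mul_same Q).trace_nonneg
  have htr0 : (σ * ρ).trace ≠ 0 := by
    intro h
    rw [hQ, ← Matrix.mul_assoc, Matrix.trace_mul_comm, ← Matrix.mul_assoc] at h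
    have := hσ.eq_zero_of_trace h
    rw [this, Matrix.zero_mul] at hQ
    obtain ⟨i⟩ := hnonempty
    have h1 := hρ.diag_pos (i := i)
    rw [hQ] at h1
    simp at h1
  have htrpos : 0 < (σ * ρ).trace := lt_of_le_of_ne hnonneg htr0.symm
  set t := (σ * ρ).trace
  set T := krausMap K K with hT
  have hdual : ∀ X, (σ * T X).trace = (σ * X).trace := by
    intro X
    conv_rhs => rw [← hσK]
    rw [hT, krausMap_apply, Matrix.mul_sum, Matrix.sum_mul, Matrix.trace_sum, Matrix.trace_sum]
    refine Finset.sum_congr rfl fun s _ => ?_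
    rw [← Matrix.mul_assoc, Matrix.trace_mul_comm]
    simp only [Matrix.mul_assoc]
  have hfix : ∀ X, T X = X → X = (t⁻¹ * (σ * X).trace) • ρ := by
    intro X hX
    have hXY : X = X * ρ⁻¹ * ρ := by
      rw [Matrix.mul_assoc, Matrix.nonsing_inv_mul _ ((Matrix.isUnit_iff_isUnit_det _).1 hρ.isUnit),
        Matrix.mul_one]
    have hY := intertwines_of_fixed hσ hσK hρ hρK (Y := X * ρ⁻¹) (by rw [← hXY, hX])
    obtain ⟨z, hz⟩ := hK.irreducible.commutant_scalar hY
    rw [hz, Matrix.smul_mul, Matrix.one_mul] at hXY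
    rw [hXY, Matrix.mul_smul, Matrix.trace_smul, smul_eq_mul]
    congr 1
    change z = t⁻¹ * (z * t)
    field_simp
  -- There is no Jordan block at 1: by induction (T - 1)X is fixed, hence a multiple of ρ, and its
  -- coefficient tr(σ(T - 1)X) vanishes because T preserves X ↦ tr(σX).
  have hsemi : ∀ k : ℕ, ∀ X, ((T - 1) ^ k : Module.End ℂ (Matrix n n ℂ)) X = 0 → k ≠ 0 → T X = X := by
    intro k
    induction k with
    | zero => exact fun X _ h => (h rfl).elim
    | succ k ih =>
      intro X hX _
      rw [pow_succ, Module.End.mul_apply] at hX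
      by_cases hk : k = 0
      · subst hk
        simpa [sub_eq_zero] using hX
      have h1 := hfix _ (ih _ hX hk)
      rw [LinearMap.sub_apply, Module.End.one_apply, Matrix.mul_sub, Matrix.trace_sub, hdual,
        sub_self, mul_zero, zero_smul] at h1
      exact sub_eq_zero.1 h1
  obtain ⟨a, ha⟩ := krausMap_of_nilpotent hK.nilpotent
  have hdualpow : ∀ N X, (σ * (T ^ N) X).trace = (σ * X).trace := by
    intro N X
    induction N with
    | zero => simp
    | succ N ih => rw [pow_succ', Module.End.mul_apply, hdual, ih]
  -- The exponent a + 1 instead of a only ensures that it is nonzero, as `hsemi` requires.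
  have hpow : ∀ X, T ((T ^ (a + 1)) X) = (T ^ (a + 1)) X := by
    intro X
    refine hsemi (a + 1) _ ?_ (by omega)
    have hc : Commute T (T - 1) := (Commute.refl T).sub_right (Commute.one_right T)
    rw [← Module.End.mul_apply, ← ((hc.pow_pow _ _).eq), ← hc.mul_pow, pow_succ, ha, zero_mul,
      LinearMap.zero_apply]
  refine ⟨ρ, t⁻¹ • σ, a + 1, hρ, hσ.smul (by exact inv_pos.2 htrpos), ?_, fun N hN X => ?_⟩
  · rw [Matrix.smul_mul, Matrix.trace_smul, smul_eq_mul, inv_mul_cancel₀ htr0]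
  · have hst : (T ^ N) X = (T ^ (a + 1)) X := by
      induction N, hN using Nat.le_induction with
      | base => rfl
      | succ N _ ih => rw [pow_succ', Module.End.mul_apply, ih, hpow]
    rw [hst, hfix _ (hpow X), hdualpow, Matrix.smul_mul, Matrix.trace_smul, smul_eq_mul]

/-- Irreducibility of the words: if the range of P is invariant under all words of length N, then (1
- P) T^N(PP†) (1 - P)† = 0. Here T^N(PP†) = tr(σPP†) ρ with σ, ρ positive definite, so either P = 0
or P = 1. -/
theorem IsNormalizedFamily.exists_mixedTransfer_pow {K : S → Matrix n n ℂ}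
    (hK : IsNormalizedFamily K) :
    ∃ a : ℕ, ∀ N ≥ a, IsIrreducibleFamily (wordProd K N) ∧
      ∃ r s : n × n → ℂ, r ⬝ᵥ s = 1 ∧ mixedTransfer K K ^ N = Matrix.vecMulVec r s := by
  obtain ⟨ρ, σ, a, hρ, hσ, htr, hpow⟩ := hK.exists_krausMap_pow
  refine ⟨a, fun N hN => ⟨fun P hP hinv => ?_, fun p => ρ p.1 p.2, fun p => σ p.2 p.1, ?_, ?_⟩⟩
  · have h1 : krausMap (wordProd K N) (wordProd K N) (P * Pᴴ) = (σ * (P * Pᴴ)).trace • ρ := by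
      rw [← hpow N hN, ← matrixActionEquiv_mixedTransfer, mixedTransfer_wordProd, map_pow,
        matrixActionEquiv_mixedTransfer]
    have h2 : (1 - P) * krausMap (wordProd K N) (wordProd K N) (P * Pᴴ) * (1 - P)ᴴ = 0 := by
      rw [krausMap_apply, Matrix.mul_sum, Matrix.sum_mul]
      refine Finset.sum_eq_zero fun w _ => ?_
      have : (1 - P) * wordProd K N w * P = 0 := by
        rw [sub_mul, sub_mul, one_mul, ← hinv w, sub_self]
      rw [show (1 - P) * (wordProd K N w * (P * Pᴴ) * (wordProd K N w)ᴴ) =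
        (1 - P) * wordProd K N w * P * (Pᴴ * (wordProd K N w)ᴴ) by simp only [mul_assoc], this,
        zero_mul, zero_mul]
    rw [h1, Matrix.mul_smul, Matrix.smul_mul, smul_eq_zero] at h2
    rcases h2 with h2 | h2
    · left
      refine hσ.eq_zero_of_trace (C := P) ?_
      rw [← h2, mul_assoc, Matrix.trace_mul_comm, mul_assoc]
    · right
      exact (sub_eq_zero.1 (hρ.eq_zero_of_conj h2)).symm
  · rw [← htr]
    simp only [dotProduct, Fintype.sum_prod_type, Matrix.trace, Matrix.diag_apply, Matrix.mul_apply]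
    rw [Finset.sum_comm]
    simp only [mul_comm]
  · apply (matrixActionEquiv n n).injective
    rw [map_pow, matrixActionEquiv_mixedTransfer]
    refine LinearMap.ext fun X => ?_
    rw [hpow N hN]
    ext i j
    rw [matrixActionEquiv_apply, Matrix.vecMulVec_mulVec]
    simp only [dotProduct, Fintype.sum_prod_type, Matrix.trace, Matrix.diag_apply, Matrix.mul_apply,
      Matrix.smul_apply, Pi.smul_apply, smul_eq_mul, MulOpposite.smul_eq_mul_unop]
    rw [Finset.sum_comm, mul_comm]
    simp

/-- Irreducible families with a nilpotent transfer matrix vanish. -/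
theorem IsIrreducibleFamily.eq_zero_of_isNilpotent [Nonempty n] {K : S → Matrix n n ℂ}
    (hK : IsIrreducibleFamily K) (h : IsNilpotent (mixedTransfer K K)) (s : S) : K s = 0 := by
  obtain ⟨N, hN⟩ := h
  have hw : ∀ w : Fin N → S, wordProd K N w = 0 := by
    refine wordProd_eq_zero_of_krausMap_pow_one ?_
    rw [← matrixActionEquiv_mixedTransfer, ← map_pow, hN, map_zero, LinearMap.zero_apply]
  clear hN
  induction N with
  | zero => exact (one_ne_zero (hw Fin.elim0)).elim
  | succ N ih =>
    by_cases hall : ∀ w : Fin N → S, wordProd K N w = 0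
    · exact ih hall
    push Not at hall
    obtain ⟨w, hw0⟩ := hall
    -- The common kernel is invariant and contains the range of the nonzero word w, since all longer
    -- words K s * w vanish. It is therefore the whole space.
    let W : Submodule ℂ (n → ℂ) := ⨅ s, LinearMap.ker (K s).mulVecLin
    have hmem : ∀ v, v ∈ W ↔ ∀ s, K s *ᵥ v = 0 := by
      intro v
      simp [W, Submodule.mem_iInf]
    rcases hK.submodule_eq W (fun s v hv => by
      rw [(hmem v).1 hv s]
      exact W.zero_mem) with hb | ht
    · refine (hw0 (Matrix.ext_of_mulVec_single fun i => ?_)).elim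
      have : wordProd K N w *ᵥ Pi.single i 1 ∈ W := by
        rw [hmem]
        intro s
        rw [Matrix.mulVec_mulVec, ← wordProd_cons, hw, Matrix.zero_mulVec]
      rw [hb, Submodule.mem_bot] at this
      rw [this, Matrix.zero_mulVec]
    · refine Matrix.ext_of_mulVec_single fun i => ?_
      rw [Matrix.zero_mulVec]
      exact (hmem _).1 (ht ▸ Submodule.mem_top) s

end Intertwiners

/-! ### Transfer matrices of tensors and the trace identity -/

section TensorFamilies

open scoped ComplexOrder Matrix

variable {O I B B' : Type*} [Fintype O] [Fintype I] [Fintype B] [Fintype B']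
  [DecidableEq O] [DecidableEq I] [DecidableEq B] [DecidableEq B']

/-- The family of matrices of a tensor, normalized by the square root of the input dimension. -/
noncomputable def tensorFamily (V : MPOTensor O I B) : O × I → Matrix B B ℂ :=
  fun s => (((Real.sqrt (Fintype.card I))⁻¹ : ℝ) : ℂ) • V s.1 s.2

theorem mixedTransfer_tensorFamily (V : MPOTensor O I B) (W : MPOTensor O I B') :
    mixedTransfer (tensorFamily V) (tensorFamily W) = transfer V W := by
  have h : (((Real.sqrt (Fintype.card I))⁻¹ : ℝ) : ℂ) * (((Real.sqrt (Fintype.card I))⁻¹ : ℝ) : ℂ) =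
      (Fintype.card I : ℂ)⁻¹ := by
    rw [← Complex.ofReal_mul, ← mul_inv, Real.mul_self_sqrt (Nat.cast_nonneg _)]
    simp
  rw [mixedTransfer, transfer, ← Fintype.sum_prod_type', Finset.smul_sum]
  refine Finset.sum_congr rfl fun s _ => ?_
  ext a b
  simp only [tensorFamily, Matrix.kroneckerMap_apply, Matrix.map_apply, Matrix.smul_apply,
    smul_eq_mul, map_mul, Complex.conj_ofReal, ← h]
  ring

theorem tensorFamily_scalar_ne_zero [Nonempty I] :
    (((Real.sqrt (Fintype.card I))⁻¹ : ℝ) : ℂ) ≠ 0 := by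
  have : (0 : ℝ) < Fintype.card I := by exact_mod_cast Fintype.card_pos
  exact_mod_cast (inv_pos.2 (Real.sqrt_pos.2 this)).ne'

theorem isIrreducibleFamily_smul_iff {S : Type*} {K L : S → Matrix B B ℂ} {z : ℂ} (hz : z ≠ 0)
    (h : ∀ s, K s = z • L s) : IsIrreducibleFamily K ↔ IsIrreducibleFamily L := by
  have : ∀ (P : Matrix B B ℂ) s, K s * P = P * K s * P ↔ L s * P = P * L s * P := by
    intro P s
    rw [h, Matrix.smul_mul, Matrix.mul_smul, Matrix.smul_mul]
    exact (smul_right_injective _ hz).eq_iff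
  simp only [IsIrreducibleFamily, this]

theorem isIrreducibleFamily_tensorFamily [Nonempty I] (V : MPOTensor O I B) :
    IsIrreducibleFamily (tensorFamily V) ↔
      ∀ P : Matrix B B ℂ, P * P = P → (∀ o i, V o i * P = P * V o i * P) → P = 0 ∨ P = 1 := by
  rw [isIrreducibleFamily_smul_iff (K := tensorFamily V) (L := fun s : O × I => V s.1 s.2)
    (tensorFamily_scalar_ne_zero (I := I)) fun s => rfl]
  simp only [IsIrreducibleFamily, Prod.forall]

theorem wordProd_tensorFamily (V : MPOTensor O I B) (N : ℕ) (w : Fin N → O × I) :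
    wordProd (tensorFamily V) N w = (((Real.sqrt (Fintype.card I))⁻¹ : ℝ) : ℂ) ^ N •
      blocked V N (fun k => (w k).1) (fun k => (w k).2) := by
  induction N with
  | zero => simp [wordProd, blocked]
  | succ N ih =>
    simp only [wordProd, blocked] at ih
    simp only [wordProd, blocked, List.ofFn_succ, List.prod_cons, ih fun k => w k.succ]
    rw [tensorFamily, Matrix.smul_mul, Matrix.mul_smul, smul_smul, pow_succ']

theorem transfer_blocked (V : MPOTensor O I B) (W : MPOTensor O I B') (N : ℕ) :
    transfer (blocked V N) (blocked W N) = transfer V W ^ N := by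
  have h : (((Real.sqrt (Fintype.card I))⁻¹ : ℝ) : ℂ) * (((Real.sqrt (Fintype.card I))⁻¹ : ℝ) : ℂ) =
      (Fintype.card I : ℂ)⁻¹ := by
    rw [← Complex.ofReal_mul, ← mul_inv, Real.mul_self_sqrt (Nat.cast_nonneg _)]
    simp
  rw [← mixedTransfer_tensorFamily V W, ← mixedTransfer_wordProd, mixedTransfer, transfer,
    ← Fintype.sum_prod_type', Finset.smul_sum,
    ← (Equiv.arrowProdEquivProdArrow (Fin N) (fun _ => O) (fun _ => I)).sum_comp]
  refine Finset.sum_congr rfl fun w _ => ?_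
  rw [wordProd_tensorFamily, wordProd_tensorFamily]
  ext a b
  simp only [Matrix.kroneckerMap_apply, Matrix.map_apply, Matrix.smul_apply,
    smul_eq_mul, map_mul, map_pow, Complex.conj_ofReal, Equiv.arrowProdEquivProdArrow_apply]
  rw [Fintype.card_fun, Fintype.card_fin, Nat.cast_pow, ← inv_pow, ← h, mul_pow]
  ring

theorem trace_transfer (V : MPOTensor O I B) (W : MPOTensor O I B') :
    (transfer V W).trace =
      (Fintype.card I : ℂ)⁻¹ * ∑ o, ∑ i, (V o i).trace * starRingEnd ℂ (W o i).trace := by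
  rw [transfer, Matrix.trace_smul, smul_eq_mul, Matrix.trace_sum]
  congr 1
  refine Finset.sum_congr rfl fun o _ => ?_
  rw [Matrix.trace_sum]
  refine Finset.sum_congr rfl fun i _ => ?_
  rw [Matrix.trace_kronecker, ← AddMonoidHom.map_trace]

theorem transfer_smul {V V' : MPOTensor O I B} {W W' : MPOTensor O I B'} {z z' : ℂ}
    (hV : ∀ o i, V' o i = z • V o i) (hW : ∀ o i, W' o i = z' • W o i) :
    transfer V' W' = (z * starRingEnd ℂ z') • transfer V W := by
  simp only [transfer, Finset.smul_sum]
  refine Finset.sum_congr rfl fun o _ => Finset.sum_congr rfl fun i _ => ?_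
  ext a b
  simp only [hV, hW, Matrix.kroneckerMap_apply, Matrix.map_apply, Matrix.smul_apply, smul_eq_mul,
    map_mul]
  ring

/-- Blocking all N sites reduces this to N = 1, where the trace of a Kronecker product factorizes.
It is the bridge between operators and transfer matrices. -/
theorem sum_mpo_mul_conj [Nonempty I] (V : MPOTensor O I B) (W : MPOTensor O I B') (N : ℕ) :
    ∑ o, ∑ i, mpo V N o i * starRingEnd ℂ (mpo W N o i) =
      (Fintype.card I : ℂ) ^ N * (transfer V W ^ N).trace := by
  rw [← transfer_blocked, trace_transfer, ← mul_assoc, Fintype.card_fun, Fintype.card_fin,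
    Nat.cast_pow, mul_inv_cancel₀, one_mul]
  · rfl
  · exact pow_ne_zero _ (by exact_mod_cast Fintype.card_ne_zero)

/-- The trace of V_N† V_N = c. The isometry property enters the whole argument only through this
scalar identity. -/
theorem GeneratesSMPI.sum_normSq {V : MPOTensor O I B} {c : ℝ} (hV : GeneratesSMPI V c) {N : ℕ}
    (hN : 1 ≤ N) :
    ∑ o, ∑ i, mpo V N o i * starRingEnd ℂ (mpo V N o i) = (Fintype.card I : ℂ) ^ N * c := by
  have h := congrArg Matrix.trace (hV.2 N hN)
  rw [Matrix.trace_smul, Matrix.trace_one, Fintype.card_fun, Fintype.card_fin, smul_eq_mul,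
    Nat.cast_pow, mul_comm] at h
  rw [← h, Matrix.trace, Finset.sum_comm]
  refine Finset.sum_congr rfl fun i _ => ?_
  rw [Matrix.diag_apply, Matrix.mul_apply]
  refine Finset.sum_congr rfl fun o _ => ?_
  rw [Matrix.conjTranspose_apply, mul_comm]
  rfl

/-- The traces of the transfer matrices of the components of an isometry add up to its constant. -/
theorem GeneratesSMPI.sum_trace [Nonempty I] {V : MPOTensor O I B} {c : ℝ}
    (hV : GeneratesSMPI V c) {ι : Type*} [Fintype ι] {κ : ι → Type*} [∀ a, Fintype (κ a)]
    [∀ a, DecidableEq (κ a)] {W : ∀ a, MPOTensor O I (κ a)} {N : ℕ} (hN : 1 ≤ N)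
    (h : mpo V N = ∑ a, mpo (W a) N) :
    ∑ t : ι × ι, (transfer (W t.1) (W t.2) ^ N).trace = c := by
  have hd : (Fintype.card I : ℂ) ^ N ≠ 0 :=
    pow_ne_zero _ (by exact_mod_cast Fintype.card_ne_zero)
  apply mul_left_cancel₀ hd
  rw [← hV.sum_normSq hN, h, Finset.mul_sum, eq_comm]
  simp only [← sum_mpo_mul_conj, Matrix.sum_apply, map_sum, Finset.sum_mul_sum]
  have := Finset.sum_comm (s := (Finset.univ : Finset ((Fin N → O) × (Fin N → I))))
    (t := (Finset.univ : Finset (ι × ι)))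
    (f := fun p t => mpo (W t.1) N p.1 p.2 * starRingEnd ℂ (mpo (W t.2) N p.1 p.2))
  simpa only [Fintype.sum_prod_type] using this

/-- The trace identity runs over all pairs of components, so the power-sum lemma controls the mixed
transfer matrices together with the diagonal ones. No normality is assumed of the components, so it
serves both an arbitrary canonical form and the construction of one. -/
theorem GeneratesSMPI.isNilpotent [Nonempty I] {V : MPOTensor O I B} {c : ℝ}
    (hV : GeneratesSMPI V c) {ι : Type*} [Fintype ι] {κ : ι → Type*} [∀ a, Fintype (κ a)]
    [∀ a, DecidableEq (κ a)] {W : ∀ a, MPOTensor O I (κ a)}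
    (h : ∀ N : ℕ, 1 ≤ N → mpo V N = ∑ a, mpo (W a) N) (a a' : ι) :
    IsNilpotent (transfer (W a) (W a') * (transfer (W a) (W a') - 1)) := by
  classical
  exact Matrix.isNilpotent_mul_sub_one_of_sum_trace_pow
    (fun t : ι × ι => transfer (W t.1) (W t.2)) c (fun N hN => hV.sum_trace hN (h N hN)) (a, a')

theorem eq_zero_or_eq_one_of_isNilpotent {E : Matrix B B ℂ} (h : IsNilpotent (E * (E - 1)))
    {z : ℂ} {v : B → ℂ} (hv : v ≠ 0) (hE : E *ᵥ v = z • v) : z = 0 ∨ z = 1 := by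
  obtain ⟨k, hk⟩ := h
  have h1 : (E * (E - 1)) *ᵥ v = (z * (z - 1)) • v := by
    rw [← Matrix.mulVec_mulVec, Matrix.sub_mulVec, Matrix.one_mulVec, hE, Matrix.mulVec_sub,
      Matrix.mulVec_smul, hE, mul_sub, mul_one, sub_smul, smul_smul]
  have h2 : ∀ j : ℕ, ((E * (E - 1)) ^ j) *ᵥ v = (z * (z - 1)) ^ j • v := by
    intro j
    induction j with
    | zero => simp
    | succ j ih =>
      rw [pow_succ, ← Matrix.mulVec_mulVec, h1, Matrix.mulVec_smul, ih, smul_smul, pow_succ']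
  have h3 := h2 k
  rw [hk, Matrix.zero_mulVec, eq_comm, smul_eq_zero] at h3
  have h4 := eq_zero_of_pow_eq_zero (h3.resolve_right hv)
  simpa [sub_eq_zero] using h4

theorem exists_eigenvector_of_mem_spectrum {E : Matrix B B ℂ} {z : ℂ} (h : z ∈ spectrum ℂ E) :
    ∃ v : B → ℂ, v ≠ 0 ∧ E *ᵥ v = z • v := by
  rw [← AlgEquiv.spectrum_eq (Matrix.toLinAlgEquiv' (R := ℂ) (n := B)),
    ← Module.End.hasEigenvalue_iff_mem_spectrum] at h
  obtain ⟨v, hv⟩ := h.exists_hasEigenvector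
  exact ⟨v, hv.2, hv.apply_eq_smul⟩

theorem mem_spectrum_of_eigenvector {E : Matrix B B ℂ} {z : ℂ} {v : B → ℂ} (hv : v ≠ 0)
    (hE : E *ᵥ v = z • v) : z ∈ spectrum ℂ E := by
  rw [← AlgEquiv.spectrum_eq (Matrix.toLinAlgEquiv' (R := ℂ) (n := B)),
    ← Module.End.hasEigenvalue_iff_mem_spectrum]
  exact Module.End.hasEigenvalue_of_hasEigenvector
    ⟨Module.End.mem_eigenspace_iff.2 hE, hv⟩

theorem not_isNilpotent_of_eigenvector {E : Matrix B B ℂ} {z : ℂ} (hz : z ≠ 0) {v : B → ℂ}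
    (hv : v ≠ 0) (hE : E *ᵥ v = z • v) : ¬ IsNilpotent E := by
  rintro ⟨k, hk⟩
  have h2 : ∀ j : ℕ, (E ^ j) *ᵥ v = z ^ j • v := by
    intro j
    induction j with
    | zero => simp
    | succ j ih =>
      rw [pow_succ, ← Matrix.mulVec_mulVec, hE, Matrix.mulVec_smul, ih, smul_smul, pow_succ']
  have h3 := h2 k
  rw [hk, Matrix.zero_mulVec, eq_comm, smul_eq_zero] at h3
  exact hz (eq_zero_of_pow_eq_zero (h3.resolve_right hv))

theorem exists_fixed_vector {E : Matrix B B ℂ} (h : IsNilpotent (E * (E - 1)))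
    (hE : ¬ IsNilpotent E) : ∃ v : B → ℂ, v ≠ 0 ∧ E *ᵥ v = (1 : ℂ) • v := by
  have hinj := (Matrix.toLinAlgEquiv' (R := ℂ) (n := B)).injective
  rw [← IsNilpotent.map_iff hinj] at h hE
  obtain ⟨v, hv, hv1⟩ := Module.End.exists_fixed_of_not_isNilpotent
    (T := Matrix.toLinAlgEquiv' E) (by simpa only [map_mul, map_sub, map_one] using h) hE
  exact ⟨v, hv, by rw [one_smul]; exact hv1⟩

theorem IsNormalizedFamily.isNormalTensor [Nonempty I] {V : MPOTensor O I B}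
    (h : IsNormalizedFamily (tensorFamily V)) : IsNormalTensor V := by
  have hnil := h.nilpotent
  have hnot := h.not_nilpotent
  rw [mixedTransfer_tensorFamily] at hnil hnot
  have hspec : ∀ z ∈ spectrum ℂ (transfer V V), z = 0 ∨ z = 1 := by
    intro z hz
    obtain ⟨v, hv, hE⟩ := exists_eigenvector_of_mem_spectrum hz
    exact eq_zero_or_eq_one_of_isNilpotent hnil hv hE
  obtain ⟨v, hv, hE⟩ := exists_fixed_vector hnil hnot
  have h1 := mem_spectrum_of_eigenvector hv hE
  refine ⟨(isIrreducibleFamily_tensorFamily V).1 h.irreducible, ?_, h1, fun z hz hz1 => ?_⟩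
  · apply le_antisymm
    · refine iSup₂_le fun z hz => ?_
      rcases hspec z hz with rfl | rfl <;> simp
    · exact le_trans (by simp) (le_iSup₂ (f := fun z (_ : z ∈ spectrum ℂ (transfer V V)) =>
        (‖z‖₊ : ENNReal)) (1 : ℂ) h1)
  · rcases hspec z hz with rfl | rfl
    · simp at hz1
    · rfl

/-- A fixed vector of the transfer matrix of `V` becomes an eigenvector for |z|² ≠ 0, which excludes
nilpotency for `W`. -/
theorem IsNormalTensor.isNormalizedFamily_smul [Nonempty I] {V : MPOTensor O I B}
    (h : IsNormalTensor V) {z : ℂ} (hz : z ≠ 0) {W : MPOTensor O I B}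
    (hW : ∀ o i, W o i = z • V o i)
    (hnil : IsNilpotent (transfer W W * (transfer W W - 1))) :
    IsNormalizedFamily (tensorFamily W) := by
  refine ⟨?_, ?_, ?_⟩
  · rw [isIrreducibleFamily_smul_iff hz (L := tensorFamily V) fun s => ?_,
      isIrreducibleFamily_tensorFamily]
    · exact h.1
    · rw [tensorFamily, tensorFamily, hW, smul_comm]
  · rwa [mixedTransfer_tensorFamily]
  · rw [mixedTransfer_tensorFamily]
    obtain ⟨v, hv, hE⟩ := exists_eigenvector_of_mem_spectrum h.2.2.1
    refine not_isNilpotent_of_eigenvector (z := z * starRingEnd ℂ z) ?_ hv ?_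
    · exact mul_ne_zero hz ((map_ne_zero _).2 hz)
    · rw [transfer_smul hW hW, Matrix.smul_mulVec, hE, one_smul]

end TensorFamilies

/-! ### Operators, blocking and direct sums -/

section Operators

open scoped ComplexOrder Matrix

variable {O I B B' : Type*} [Fintype O] [Fintype I] [Fintype B] [Fintype B']
  [DecidableEq O] [DecidableEq I] [DecidableEq B] [DecidableEq B']

theorem mpo_eq_trace_blocked (V : MPOTensor O I B) (N : ℕ) (o : Fin N → O) (i : Fin N → I) :
    mpo V N o i = (blocked V N o i).trace := rfl

theorem blocked_succ (V : MPOTensor O I B) (N : ℕ) (o : Fin (N + 1) → O) (i : Fin (N + 1) → I) :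
    blocked V (N + 1) o i = V (o 0) (i 0) * blocked V N (fun k => o k.succ) (fun k => i k.succ) := by
  simp [blocked, List.ofFn_succ]

theorem blocked_smul {V W : MPOTensor O I B} {z : ℂ} (h : ∀ o i, W o i = z • V o i) (N : ℕ)
    (o : Fin N → O) (i : Fin N → I) : blocked W N o i = z ^ N • blocked V N o i := by
  induction N with
  | zero => simp [blocked]
  | succ N ih => rw [blocked_succ, blocked_succ, ih, h, Matrix.smul_mul, Matrix.mul_smul, smul_smul,
      pow_succ']

theorem mpo_smul {V W : MPOTensor O I B} {z : ℂ} (h : ∀ o i, W o i = z • V o i) (N : ℕ) :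
    mpo W N = z ^ N • mpo V N := by
  ext o i
  rw [Matrix.smul_apply, mpo_eq_trace_blocked, mpo_eq_trace_blocked, blocked_smul h,
    Matrix.trace_smul]

/-- The configuration of `N * L` sites that belongs to a configuration of `N` groups of `L`. -/
def ungroup {α : Type*} {N L : ℕ} (x : Fin N → Fin L → α) : Fin (N * L) → α :=
  fun k => x (finProdFinEquiv.symm k).1 (finProdFinEquiv.symm k).2

/-- Grouping sites does not change the operator. -/
theorem mpo_blocked (V : MPOTensor O I B) (L N : ℕ) (o : Fin N → Fin L → O)
    (i : Fin N → Fin L → I) : mpo (blocked V L) N o i = mpo V (N * L) (ungroup o) (ungroup i) := by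
  rw [mpo, mpo, List.ofFn_mul, List.prod_flatten, List.map_ofFn]
  congr 3
  funext k
  simp only [Function.comp_apply, blocked]
  congr 2
  funext l
  have h : ∀ hlt, (⟨k * L + l, hlt⟩ : Fin (N * L)) = finProdFinEquiv (k, l) := by
    intro hlt
    ext
    simp only [finProdFinEquiv_apply_val]
    ring
  rw [h]
  simp only [ungroup, Equiv.symm_apply_apply]

/-- By `sum_mpo_mul_conj` the Gram matrix of the operators is a nonzero multiple of the identity. -/
theorem linearIndependent_mpo [Nonempty I] {ι : Type*} [Fintype ι] [DecidableEq ι] {κ : ι → Type*}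
    [∀ a, Fintype (κ a)] [∀ a, DecidableEq (κ a)] {W : ∀ a, MPOTensor O I (κ a)} {N : ℕ}
    (h : ∀ a a', (transfer (W a) (W a') ^ N).trace = if a = a' then 1 else 0) :
    LinearIndependent ℂ fun a => mpo (W a) N := by
  rw [Fintype.linearIndependent_iff]
  intro x hx b
  have hd : (Fintype.card I : ℂ) ^ N ≠ 0 :=
    pow_ne_zero _ (by exact_mod_cast Fintype.card_ne_zero)
  have h1 : ∑ a, x a * ∑ o, ∑ i, mpo (W a) N o i * starRingEnd ℂ (mpo (W b) N o i) = 0 := by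
    have h2 : ∀ o i, ∑ a, x a * mpo (W a) N o i = 0 := by
      intro o i
      have := congrFun (congrFun hx o) i
      simpa [Matrix.sum_apply] using this
    have h3 : ∑ p : (Fin N → O) × (Fin N → I), (∑ a, x a * mpo (W a) N p.1 p.2) *
        starRingEnd ℂ (mpo (W b) N p.1 p.2) = 0 := by simp [h2]
    rw [← h3]
    simp only [Finset.sum_mul]
    rw [Finset.sum_comm]
    simp only [Fintype.sum_prod_type, Finset.mul_sum, mul_assoc]
  simp only [sum_mpo_mul_conj, h] at h1
  simpa [hd] using h1

/-- The intertwiner passes through whole words and cancels under the trace. -/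
theorem mpo_eq_of_similar [Nonempty I] {V : MPOTensor O I B} {W : MPOTensor O I B'}
    (h : AreSimilar (tensorFamily V) (tensorFamily W)) (N : ℕ) : mpo V N = mpo W N := by
  obtain ⟨Y, Y', h1, h2, hY⟩ := h
  have hY1 : ∀ o i, V o i * Y = Y * W o i := by
    intro o i
    have := hY (o, i)
    rw [tensorFamily, tensorFamily, Matrix.smul_mul, Matrix.mul_smul] at this
    exact smul_right_injective _ tensorFamily_scalar_ne_zero this
  have hb : ∀ (N : ℕ) (o : Fin N → O) (i : Fin N → I),
      blocked V N o i * Y = Y * blocked W N o i := by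
    intro N
    induction N with
    | zero => intro o i; simp [blocked]
    | succ N ih =>
      intro o i
      rw [blocked_succ, blocked_succ, Matrix.mul_assoc, ih, ← Matrix.mul_assoc, hY1,
        Matrix.mul_assoc]
  ext o i
  rw [mpo_eq_trace_blocked, mpo_eq_trace_blocked, ← Matrix.mul_one (blocked V N o i), ← h1,
    ← Matrix.mul_assoc, hb, Matrix.trace_mul_comm, ← Matrix.mul_assoc, h2, Matrix.one_mul]

/-- The tensor `⊕_j (diag(μ_j) ⊗ A_j)`. -/
noncomputable def weightedSum {g : ℕ} {D : Fin g → ℕ} (m : Fin g → ℕ) (μ : (j : Fin g) → Fin (m j) → ℂ)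
    (A : (j : Fin g) → MPOTensor O I (Fin (D j))) :
    MPOTensor O I (Σ j : Fin g, Fin (m j) × Fin (D j)) :=
  fun o i => Matrix.blockDiagonal' fun j => Matrix.diagonal (μ j) ⊗ₖ A j o i

theorem multiplicitySum_eq {g : ℕ} {D : Fin g → ℕ} (m : Fin g → ℕ)
    (A : (j : Fin g) → MPOTensor O I (Fin (D j))) :
    multiplicitySum m A = weightedSum m (fun _ _ => 1) A := by
  funext o i
  simp [multiplicitySum, weightedSum]

theorem weightedSum_eq_multiplicitySum {g : ℕ} {D : Fin g → ℕ} {m : Fin g → ℕ}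
    {μ : (j : Fin g) → Fin (m j) → ℂ} {φ : Fin g → ℂ} (hμ : ∀ j q, μ j q = φ j)
    {A W : (j : Fin g) → MPOTensor O I (Fin (D j))} (hW : ∀ j o i, W j o i = φ j • A j o i) :
    weightedSum m μ A = multiplicitySum m W := by
  funext o i
  rw [multiplicitySum, weightedSum]
  congr 1
  funext j
  have : Matrix.diagonal (μ j) = φ j • (1 : Matrix (Fin (m j)) (Fin (m j)) ℂ) := by
    rw [← Matrix.diagonal_one, ← Matrix.diagonal_smul]
    congr 1
    funext q
    simp [hμ]
  rw [this, hW, Matrix.smul_kronecker, Matrix.kronecker_smul]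

theorem blocked_weightedSum {g : ℕ} {D : Fin g → ℕ} (m : Fin g → ℕ)
    (μ : (j : Fin g) → Fin (m j) → ℂ) (A : (j : Fin g) → MPOTensor O I (Fin (D j))) (L : ℕ) :
    blocked (weightedSum m μ A) L =
      weightedSum m (fun j q => μ j q ^ L) fun j => blocked (A j) L := by
  induction L with
  | zero =>
    funext o i
    simp only [blocked, weightedSum, List.ofFn_zero, List.prod_nil, pow_zero, Matrix.diagonal_one,
      Matrix.one_kronecker_one]
    exact Matrix.blockDiagonal'_one.symm
  | succ L ih =>
    funext o i
    rw [blocked_succ, ih, weightedSum, weightedSum, weightedSum, ← Matrix.blockDiagonal'_mul]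
    congr 1
    funext j
    rw [← Matrix.mul_kronecker_mul, Matrix.diagonal_mul_diagonal, blocked_succ]
    simp only [pow_succ']

theorem mpo_weightedSum {g : ℕ} {D : Fin g → ℕ} (m : Fin g → ℕ)
    (μ : (j : Fin g) → Fin (m j) → ℂ) (A : (j : Fin g) → MPOTensor O I (Fin (D j))) (N : ℕ) :
    mpo (weightedSum m μ A) N =
      ∑ a : Σ j, Fin (m j), mpo (fun o i => μ a.1 a.2 • A a.1 o i) N := by
  ext o i
  rw [mpo_eq_trace_blocked, blocked_weightedSum, weightedSum, Matrix.trace_blockDiagonal',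
    Matrix.sum_apply, Fintype.sum_sigma]
  refine Finset.sum_congr rfl fun j _ => ?_
  rw [Matrix.trace_kronecker, Matrix.trace_diagonal, Finset.sum_mul]
  refine Finset.sum_congr rfl fun q _ => ?_
  rw [mpo_smul (V := A j) fun _ _ => rfl, Matrix.smul_apply, smul_eq_mul]
  rfl

/-- Properties of the blocked tensor of a normalized block. -/
theorem IsNormalizedFamily.exists_blocked [Nonempty I] {V : MPOTensor O I B}
    (h : IsNormalizedFamily (tensorFamily V)) :
    ∃ a : ℕ, ∀ L ≥ a, IsNormalizedFamily (tensorFamily (blocked V L)) ∧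
      (transfer V V ^ L).trace = 1 ∧
      (transfer V V ^ L) ^ 2 = transfer V V ^ L ∧
      (transfer V V ^ L).charpoly.rootMultiplicity 1 = 1 := by
  obtain ⟨a, ha⟩ := h.exists_mixedTransfer_pow
  refine ⟨a, fun L hL => ?_⟩
  obtain ⟨hirr, r, s, hrs, hE⟩ := ha L hL
  rw [mixedTransfer_tensorFamily] at hE
  have hsq : (transfer V V ^ L) ^ 2 = transfer V V ^ L := by
    rw [hE, pow_two, Matrix.vecMulVec_mul_vecMulVec, dotProduct_comm, hrs, one_smul]
  have htr : (transfer V V ^ L).trace = 1 := by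
    rw [hE, Matrix.trace_vecMulVec, hrs]
  refine ⟨⟨?_, ?_, ?_⟩, htr, hsq, ?_⟩
  · rw [isIrreducibleFamily_tensorFamily]
    intro P hP hinv
    refine hirr P hP fun w => ?_
    rw [wordProd_tensorFamily, Matrix.smul_mul, Matrix.mul_smul, Matrix.smul_mul, hinv]
  · rw [mixedTransfer_tensorFamily, transfer_blocked, mul_sub, mul_one, ← pow_two, hsq, sub_self]
    exact IsNilpotent.zero
  · rw [mixedTransfer_tensorFamily, transfer_blocked]
    rintro ⟨k, hk⟩
    have hp : ∀ k : ℕ, (transfer V V ^ L) ^ (k + 1) = transfer V V ^ L := by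
      intro k
      induction k with
      | zero => rw [zero_add, pow_one]
      | succ k ih => rw [pow_succ, ih, ← pow_two, hsq]
    have h0 : transfer V V ^ L = 0 := by rw [← hp k, pow_succ, hk, zero_mul]
    rw [h0, Matrix.trace_zero] at htr
    exact zero_ne_one htr
  · have hn : Nonempty (B × B) := by
      by_contra hempty
      rw [not_nonempty_iff] at hempty
      simp [dotProduct] at hrs
    -- For a rank-one matrix with s·r = 1 on a space of dimension k + 1, the characteristic
    -- polynomial is X^k (X - 1).
    rw [hE, Matrix.charpoly_vecMulVec, hrs, one_smul]
    obtain ⟨k, hk⟩ : ∃ k, Fintype.card (B × B) = k + 1 :=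
      ⟨Fintype.card (B × B) - 1, by have := Fintype.card_pos (α := B × B); omega⟩
    rw [hk, Nat.add_sub_cancel, show (Polynomial.X ^ (k + 1) - Polynomial.X ^ k : Polynomial ℂ) =
      Polynomial.X ^ k * (Polynomial.X - Polynomial.C 1) by rw [Polynomial.C_1]; ring,
      Polynomial.rootMultiplicity_mul (mul_ne_zero (pow_ne_zero _ Polynomial.X_ne_zero)
        (Polynomial.X_sub_C_ne_zero 1)), Polynomial.rootMultiplicity_X_sub_C_self,
      Polynomial.rootMultiplicity_eq_zero (by simp)]

end Operators

/-! ### The structure of an arbitrary canonical form -/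

section CanonicalForms

variable {O I B B' : Type*} [Fintype O] [Fintype I] [Fintype B] [Fintype B']
  [DecidableEq O] [DecidableEq I] [DecidableEq B] [DecidableEq B']

theorem exists_pow_eq_zero_of_ge {E : Matrix B B ℂ} (h : IsNilpotent E) :
    ∃ a : ℕ, ∀ L ≥ a, E ^ L = 0 := by
  obtain ⟨a, ha⟩ := h
  exact ⟨a, fun L hL => pow_eq_zero_of_le hL ha⟩

theorem mpo_mem_span {g : ℕ} {D : Fin g → ℕ} {m : Fin g → ℕ}
    {W : (j : Fin g) → MPOTensor O I (Fin (D j))} {V : MPOTensor O I B} {N : ℕ}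
    (h : mpo V N = ∑ j, (m j : ℂ) • mpo (W j) N) :
    mpo V N ∈ Submodule.span ℂ (Set.range fun j => mpo (W j) N) := by
  rw [h]
  exact Submodule.sum_mem _ fun j _ => Submodule.smul_mem _ _ (Submodule.subset_span ⟨j, rfl⟩)

/-- After blocking sufficiently many sites, pairwise inequivalent normalized blocks are weakly
orthogonal, and their transfer matrices are projectors of rank one. -/
theorem exists_stable_blocking [Nonempty I] {g : ℕ} {D : Fin g → ℕ}
    {W : (j : Fin g) → MPOTensor O I (Fin (D j))}
    (hnf : ∀ j, IsNormalizedFamily (tensorFamily (W j)))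
    (hoff : ∀ j j', j ≠ j' → IsNilpotent (transfer (W j) (W j'))) :
    ∃ L₀ : ℕ, 1 ≤ L₀ ∧
      (∀ L ≥ L₀, ∀ j, IsNormalizedFamily (tensorFamily (blocked (W j) L)) ∧
        (transfer (W j) (W j) ^ L) ^ 2 = transfer (W j) (W j) ^ L ∧
        (transfer (W j) (W j) ^ L).charpoly.rootMultiplicity 1 = 1) ∧
      (∀ L ≥ L₀, ∀ j j', j ≠ j' → transfer (W j) (W j') ^ L = 0) ∧
      ∀ L ≥ L₀, ∀ j j', (transfer (W j) (W j') ^ L).trace = if j = j' then 1 else 0 := by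
  choose a ha using fun j => (hnf j).exists_blocked
  choose b hb using fun p : {p : Fin g × Fin g // p.1 ≠ p.2} =>
    exists_pow_eq_zero_of_ge (hoff p.1.1 p.1.2 p.2)
  -- A common upper bound for all thresholds; the summand 1 keeps it positive when there are no
  -- blocks.
  set L₀ := 1 + ∑ j, a j + ∑ p, b p
  have ha0 : ∀ j, a j ≤ L₀ := fun j => by
    have := Finset.single_le_sum (f := a) (fun _ _ => Nat.zero_le _) (Finset.mem_univ j)
    omega
  have hb0 : ∀ p, b p ≤ L₀ := fun p => by
    have := Finset.single_le_sum (f := b) (fun _ _ => Nat.zero_le _) (Finset.mem_univ p)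
    omega
  have htrace : ∀ N ≥ L₀, ∀ j j', (transfer (W j) (W j') ^ N).trace = if j = j' then 1 else 0 := by
    intro N hN j j'
    split_ifs with h
    · subst h
      exact (ha j N ((ha0 j).trans hN)).2.1
    · rw [hb ⟨(j, j'), h⟩ N ((hb0 _).trans hN), Matrix.trace_zero]
  exact ⟨L₀, by omega, fun L hL j => ⟨(ha j L ((ha0 j).trans hL)).1,
    (ha j L ((ha0 j).trans hL)).2.2⟩, fun L hL j j' hne => hb ⟨(j, j'), hne⟩ L ((hb0 _).trans hL),
    htrace⟩

theorem CanonicalData.structure_of_isCanonicalForm [Nonempty I]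
    {V : MPOTensor O I B} {c : ℝ} (hV : GeneratesSMPI V c) (C : CanonicalData O I)
    (hC : C.IsCanonicalFormOf V) :
    ∃ φ : Fin C.g → ℂ, (∀ j, ‖φ j‖ = 1) ∧ (∀ j q, C.coeff j q = φ j) ∧
    ∃ W : (j : Fin C.g) → MPOTensor O I (Fin (C.D j)),
      (∀ j o i, W j o i = φ j • C.block j o i) ∧
      IsBNT W V ∧ C.tensor = multiplicitySum C.mult W ∧
      (∀ j j', j ≠ j' → IsNilpotent (transfer (W j) (W j'))) ∧
      ((∑ j, C.mult j ^ 2 : ℕ) : ℝ) = c ∧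
      ∃ L₀ : ℕ, 1 ≤ L₀ ∧ ∀ L : ℕ, L₀ ≤ L →
        IsBNT (fun j => blocked (W j) L) (blocked V L) ∧
        blocked C.tensor L = multiplicitySum C.mult (fun j => blocked (W j) L) ∧
        (∀ j j', j ≠ j' → WeaklyOrthogonal (blocked (W j) L) (blocked (W j') L)) ∧
        ∀ j, (transfer (blocked (W j) L) (blocked (W j) L)).charpoly.rootMultiplicity 1 = 1 ∧
          spectralRadius ℂ (transfer (blocked (W j) L) (blocked (W j) L)) = 1 ∧
          transfer (blocked (W j) L) (blocked (W j) L) ^ 2 =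
            transfer (blocked (W j) L) (blocked (W j) L) := by
  obtain ⟨⟨hnormal, -, N₀, hind⟩, hmpo⟩ := hC
  let U : ∀ a : Σ j, Fin (C.mult j), MPOTensor O I (Fin (C.D a.1)) :=
    fun a o i => C.coeff a.1 a.2 • C.block a.1 o i
  have hU : ∀ N : ℕ, 1 ≤ N → mpo V N = ∑ a, mpo (U a) N := fun N hN => by
    rw [← hmpo N hN]
    exact mpo_weightedSum C.mult C.coeff C.block N
  have hnil := fun a a' => hV.isNilpotent hU a a'
  -- E(A_j, A_j) has the eigenvalue 1, so the pair (j,q), (j,q') has the nonzero eigenvalue μ_q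
  -- conj(μ_q'). The case q = q' gives modulus one, and comparing different q gives equality.
  have hphase : ∀ j q q', C.coeff j q * starRingEnd ℂ (C.coeff j q') = 1 := by
    intro j q q'
    obtain ⟨v, hv, hE⟩ := exists_eigenvector_of_mem_spectrum (hnormal j).2.2.1
    have h1 := eq_zero_or_eq_one_of_isNilpotent (hnil ⟨j, q⟩ ⟨j, q'⟩)
      (z := C.coeff j q * starRingEnd ℂ (C.coeff j q')) hv (by
        rw [transfer_smul (V := C.block j) (W := C.block j) (z := C.coeff j q)
          (z' := C.coeff j q') (fun _ _ => rfl) (fun _ _ => rfl), Matrix.smul_mulVec, hE, one_smul])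
    exact h1.resolve_left
      (mul_ne_zero (C.coeff_ne_zero j q) ((map_ne_zero _).2 (C.coeff_ne_zero j q')))
  let φ : Fin C.g → ℂ := fun j => C.coeff j ⟨0, C.mult_pos j⟩
  have hφ : ∀ j q, C.coeff j q = φ j := fun j q =>
    mul_right_cancel₀ ((map_ne_zero (starRingEnd ℂ)).2 (C.coeff_ne_zero j q))
      ((hphase j q q).trans (hphase j _ q).symm)
  have hφ1 : ∀ j, ‖φ j‖ = 1 := by
    intro j
    have h := congrArg norm (hphase j ⟨0, C.mult_pos j⟩ ⟨0, C.mult_pos j⟩)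
    rw [norm_mul, RCLike.norm_conj, norm_one, ← pow_two] at h
    exact (pow_eq_one_iff_of_nonneg (norm_nonneg _) two_ne_zero).1 h
  have hφ0 : ∀ j, φ j ≠ 0 := fun j => C.coeff_ne_zero j _
  let W : (j : Fin C.g) → MPOTensor O I (Fin (C.D j)) := fun j o i => φ j • C.block j o i
  have hUW : ∀ a, U a = W a.1 := by
    intro a
    funext o i
    simp only [U, W, hφ]
  have hWnil : ∀ j j', IsNilpotent (transfer (W j) (W j') * (transfer (W j) (W j') - 1)) :=
    fun j j' => hnil ⟨j, ⟨0, C.mult_pos j⟩⟩ ⟨j', ⟨0, C.mult_pos j'⟩⟩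
  have hnf : ∀ j, IsNormalizedFamily (tensorFamily (W j)) := fun j =>
    (hnormal j).isNormalizedFamily_smul (hφ0 j) (fun _ _ => rfl) (hWnil j j)
  have hoff : ∀ j j', j ≠ j' → IsNilpotent (transfer (W j) (W j')) := by
    intro j j' hne
    have h := (hnf j).isNilpotent_or_similar (hnf j')
      (by simpa only [mixedTransfer_tensorFamily] using hWnil j j')
    rw [mixedTransfer_tensorFamily] at h
    refine h.resolve_right fun hsim => ?_
    -- Similar blocks would generate proportional operators, contradicting linear independence of
    -- the basis at size N₀ + 1.
    have h1 := mpo_eq_of_similar hsim (N₀ + 1)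
    rw [mpo_smul (V := C.block j) (fun _ _ => rfl),
      mpo_smul (V := C.block j') (fun _ _ => rfl)] at h1
    have h2 := Fintype.linearIndependent_iff.1 (hind (N₀ + 1) (by omega))
      (Pi.single j (φ j ^ (N₀ + 1)) - Pi.single j' (φ j' ^ (N₀ + 1)))
      (by simp [sub_smul, Finset.sum_sub_distrib, Pi.single_apply, ite_smul, h1]) j
    rw [Pi.sub_apply, Pi.single_eq_same, Pi.single_eq_of_ne hne, sub_zero] at h2
    exact hφ0 j (eq_zero_of_pow_eq_zero h2)
  have hW : ∀ N : ℕ, 1 ≤ N → mpo V N = ∑ j, (C.mult j : ℂ) • mpo (W j) N := by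
    intro N hN
    rw [hU N hN, Fintype.sum_sigma]
    refine Finset.sum_congr rfl fun j _ => ?_
    have h1 : ∑ q : Fin (C.mult j), mpo (U ⟨j, q⟩) N = ∑ q : Fin (C.mult j), mpo (W j) N :=
      Finset.sum_congr rfl fun q _ => by rw [hUW]
    rw [h1, Finset.sum_const, Finset.card_univ, Fintype.card_fin, Nat.cast_smul_eq_nsmul]
  obtain ⟨L₀, hL₀, ha, hb, htrace⟩ := exists_stable_blocking hnf hoff
  refine ⟨φ, hφ1, hφ, W, fun _ _ _ => rfl, ⟨fun j => (hnf j).isNormalTensor,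
    fun N hN => mpo_mem_span (hW N hN), L₀, fun N hN => linearIndependent_mpo (htrace N hN.le)⟩,
    weightedSum_eq_multiplicitySum hφ fun _ _ _ => rfl, hoff, ?_, L₀, hL₀, fun L hL => ?_⟩
  -- At N = L₀ each trace is 1 for two copies of the same block and 0 otherwise, so the identity
  -- counts ∑ m_j² pairs.
  · have h1 := hV.sum_trace (N := L₀) hL₀ (hU L₀ hL₀)
    have h2 : ∀ t : (Σ j, Fin (C.mult j)) × (Σ j, Fin (C.mult j)),
        (transfer (U t.1) (U t.2) ^ L₀).trace = if t.1.1 = t.2.1 then 1 else 0 := by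
      intro t
      rw [hUW, hUW]
      exact htrace L₀ le_rfl _ _
    have h3 : ∑ t : (Σ j, Fin (C.mult j)) × (Σ j, Fin (C.mult j)),
        (transfer (U t.1) (U t.2) ^ L₀).trace =
        ∑ j, ∑ _q : Fin (C.mult j), ∑ j', ∑ _q : Fin (C.mult j'), if j = j' then (1 : ℂ) else 0 := by
      rw [Fintype.sum_prod_type, Fintype.sum_sigma]
      refine Finset.sum_congr rfl fun j _ => Finset.sum_congr rfl fun q _ => ?_
      rw [Fintype.sum_sigma]
      exact Finset.sum_congr rfl fun j' _ => Finset.sum_congr rfl fun q' _ => h2 _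
    apply Complex.ofReal_injective
    rw [← h1, h3]
    simp [pow_two]
  · have hblk : ∀ j, transfer (blocked (W j) L) (blocked (W j) L) = transfer (W j) (W j) ^ L :=
      fun j => transfer_blocked _ _ L
    have hnt : ∀ j, IsNormalTensor (blocked (W j) L) := fun j =>
      (ha L hL j).1.isNormalTensor
    have hL1 : 1 ≤ L := by omega
    -- The independence threshold is 0: N ≥ 1 blocked sites are N * L ≥ L₀ original sites.
    refine ⟨⟨hnt, fun N hN => mpo_mem_span (m := C.mult) ?_, 0, fun N hN =>
      linearIndependent_mpo fun j j' => ?_⟩, ?_, fun j j' hne => ?_, fun j => ⟨?_, (hnt j).2.1, ?_⟩⟩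
    · ext o i
      rw [mpo_blocked, hW _ (Nat.mul_pos hN hL1), Matrix.sum_apply, Matrix.sum_apply]
      simp only [Matrix.smul_apply, mpo_blocked]
    · rw [transfer_blocked, ← pow_mul]
      exact htrace _ (hL.trans (Nat.le_mul_of_pos_right L hN)) j j'
    · have h1 : C.tensor = weightedSum C.mult (fun _ _ => 1) W := by
        rw [← multiplicitySum_eq]
        exact weightedSum_eq_multiplicitySum hφ fun _ _ _ => rfl
      rw [h1, blocked_weightedSum, multiplicitySum_eq]
      simp only [one_pow]
    · rw [WeaklyOrthogonal, transfer_blocked]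
      exact hb L hL j j' hne
    · rw [hblk]
      exact (ha L hL j).2.2
    · rw [hblk]
      exact (ha L hL j).2.1

end CanonicalForms

/-! ### Block triangular forms with irreducible diagonal blocks -/

section TriangularForms

/-- An idempotent matrix factors through its range. -/
theorem Matrix.exists_factorization_of_idempotent {n : Type*} [Fintype n] [DecidableEq n]
    {P : Matrix n n ℂ} (hP : P * P = P) :
    ∃ (r : ℕ) (R : Matrix n (Fin r) ℂ) (T : Matrix (Fin r) n ℂ), R * T = P ∧ T * R = 1 := by
  set p := Matrix.toLin' P with hp
  have hpp : ∀ v, p (p v) = p v := by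
    intro v
    rw [hp, Matrix.toLin'_apply, Matrix.toLin'_apply, Matrix.mulVec_mulVec, hP]
  let W := LinearMap.range p
  let e : W ≃ₗ[ℂ] (Fin (Module.finrank ℂ W) → ℂ) := (Module.finBasis ℂ W).equivFun
  let R := W.subtype ∘ₗ e.symm.toLinearMap
  let T := e.toLinearMap ∘ₗ p.rangeRestrict
  refine ⟨_, LinearMap.toMatrix' R, LinearMap.toMatrix' T, ?_, ?_⟩
  · rw [← LinearMap.toMatrix'_comp]
    have : R ∘ₗ T = p := by
      refine LinearMap.ext fun v => ?_
      simp [R, T]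
    rw [this, hp, LinearMap.toMatrix'_toLin']
  · rw [← LinearMap.toMatrix'_comp]
    have : T ∘ₗ R = LinearMap.id := by
      refine LinearMap.ext fun v => ?_
      simp only [R, T, LinearMap.comp_apply, LinearEquiv.coe_coe, LinearMap.id_apply,
        Submodule.subtype_apply]
      apply e.symm.injective
      rw [e.symm_apply_apply]
      ext1
      obtain ⟨u, hu⟩ := (e.symm v).2
      change p ((e.symm v : W) : n → ℂ) = _
      rw [← hu, hpp]
    rw [this, LinearMap.toMatrix'_id]

theorem Matrix.submatrix_left_mul_submatrix_right {l m n l' n' : Type*} [Fintype m]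
    (A : Matrix l m ℂ) (C : Matrix m n ℂ) (f : l' → l) (g : n' → n) :
    A.submatrix f id * C.submatrix id g = (A * C).submatrix f g := rfl

theorem Matrix.submatrix_left_mul_mul_submatrix_right {l m n l' n' : Type*} [Fintype m]
    (A : Matrix l m ℂ) (M : Matrix m m ℂ) (C : Matrix m n ℂ) (f : l' → l) (g : n' → n) :
    A.submatrix f id * M * C.submatrix id g = (A * M * C).submatrix f g := rfl

variable {S B B' : Type*} [Fintype B] [DecidableEq B] [Fintype B'] [DecidableEq B']
  {ι ι' : Type} [Fintype ι] [DecidableEq ι] [Fintype ι'] [DecidableEq ι']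

/-- In a suitable basis, the family `V` is block upper triangular with diagonal blocks `K`. -/
def HasTriangularForm (V : S → Matrix B B ℂ) (d : ι → ℕ)
    (K : (a : ι) → S → Matrix (Fin (d a)) (Fin (d a)) ℂ) : Prop :=
  ∃ (β : ι → ℕ) (T : Matrix (Σ a, Fin (d a)) B ℂ) (R : Matrix B (Σ a, Fin (d a)) ℂ),
    Function.Injective β ∧ T * R = 1 ∧ R * T = 1 ∧
    ∀ s, (T * V s * R).BlockTriangular (fun x => β x.1) ∧
      ∀ a x y, (T * V s * R) ⟨a, x⟩ ⟨a, y⟩ = K a s x y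

theorem HasTriangularForm.of_conj {V : S → Matrix B B ℂ} {V' : S → Matrix B' B' ℂ}
    {T : Matrix B' B ℂ} {R : Matrix B B' ℂ} (hTR : T * R = 1) (hRT : R * T = 1)
    (hV : ∀ s, T * V s * R = V' s) {d : ι → ℕ}
    {K : (a : ι) → S → Matrix (Fin (d a)) (Fin (d a)) ℂ} (h : HasTriangularForm V' d K) :
    HasTriangularForm V d K := by
  obtain ⟨β, T', R', hβ, h1, h2, h3⟩ := h
  refine ⟨β, T' * T, R * R', hβ, ?_, ?_, fun s => ?_⟩
  · rw [Matrix.mul_assoc, ← Matrix.mul_assoc T, hTR, Matrix.one_mul, h1]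
  · rw [Matrix.mul_assoc, ← Matrix.mul_assoc R', h2, Matrix.one_mul, hRT]
  · have : T' * T * V s * (R * R') = T' * V' s * R' := by
      rw [← hV]
      simp only [Matrix.mul_assoc]
    rw [this]
    exact h3 s

theorem HasTriangularForm.reindex {V : S → Matrix B B ℂ} {d : ι → ℕ}
    {K : (a : ι) → S → Matrix (Fin (d a)) (Fin (d a)) ℂ} (h : HasTriangularForm V d K)
    (ε : ι' ≃ ι) : HasTriangularForm V (fun a => d (ε a)) (fun a => K (ε a)) := by
  obtain ⟨β, T, R, hβ, h1, h2, h3⟩ := h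
  let f : (Σ a, Fin (d (ε a))) ≃ Σ a, Fin (d a) := Equiv.sigmaCongrLeft (β := fun a => Fin (d a)) ε
  refine ⟨fun a => β (ε a), T.submatrix f id, R.submatrix id f, hβ.comp ε.injective, ?_, ?_,
    fun s => ?_⟩
  · rw [Matrix.submatrix_left_mul_submatrix_right, h1, Matrix.submatrix_one_equiv]
  · rw [Matrix.submatrix_mul_equiv R T id f id, h2, Matrix.submatrix_id_id]
  · have h4 : T.submatrix f id * V s * R.submatrix id f = (T * V s * R).submatrix f f := rfl
    rw [h4]
    exact ⟨fun x y hxy => (h3 s).1 hxy, fun a x y => (h3 s).2 (ε a) x y⟩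

theorem Matrix.blockDiagonal'_mul_mul_apply {m n : ι → Type*} [∀ a, Fintype (m a)]
    [∀ a, Fintype (n a)] (P : ∀ a, Matrix (n a) (m a) ℂ) (Q : ∀ a, Matrix (m a) (n a) ℂ)
    (M : Matrix (Σ a, m a) (Σ a, m a) ℂ) (a b : ι) (x : n a) (y : n b) :
    (Matrix.blockDiagonal' P * M * Matrix.blockDiagonal' Q) ⟨a, x⟩ ⟨b, y⟩ =
      (P a * M.submatrix (Sigma.mk a) (Sigma.mk b) * Q b) x y := by
  have h1 : ∀ z, (Matrix.blockDiagonal' P * M) ⟨a, x⟩ z = ∑ u, P a x u * M ⟨a, u⟩ z := by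
    intro z
    rw [Matrix.mul_apply, Fintype.sum_sigma, Finset.sum_eq_single a]
    · simp
    · intro c _ hc
      refine Finset.sum_eq_zero fun u _ => ?_
      rw [Matrix.blockDiagonal'_apply_ne _ _ _ hc.symm, zero_mul]
    · simp
  rw [Matrix.mul_apply, Fintype.sum_sigma, Finset.sum_eq_single b]
  · simp only [h1, Matrix.blockDiagonal'_apply_eq, Matrix.mul_apply, Matrix.submatrix_apply]
  · intro c _ hc
    refine Finset.sum_eq_zero fun u _ => ?_
    rw [Matrix.blockDiagonal'_apply_ne _ _ _ hc, mul_zero]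
  · simp

/-- Conjugation by the direct sum of the intertwiners acts on each block separately, so zero blocks
stay zero. -/
theorem HasTriangularForm.congr_similar {V : S → Matrix B B ℂ} {d d' : ι → ℕ}
    {K : (a : ι) → S → Matrix (Fin (d a)) (Fin (d a)) ℂ}
    {K' : (a : ι) → S → Matrix (Fin (d' a)) (Fin (d' a)) ℂ} (h : HasTriangularForm V d K)
    (hK : ∀ a, AreSimilar (K a) (K' a)) : HasTriangularForm V d' K' := by
  obtain ⟨β, T, R, hβ, h1, h2, h3⟩ := h
  choose Y Y' hYY' hY'Y hY using hK
  have e1 : Matrix.blockDiagonal' Y * Matrix.blockDiagonal' Y' = 1 := by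
    rw [← Matrix.blockDiagonal'_mul]
    simp only [hYY']
    exact Matrix.blockDiagonal'_one
  have e2 : Matrix.blockDiagonal' Y' * Matrix.blockDiagonal' Y = 1 := by
    rw [← Matrix.blockDiagonal'_mul]
    simp only [hY'Y]
    exact Matrix.blockDiagonal'_one
  refine ⟨β, Matrix.blockDiagonal' Y' * T, R * Matrix.blockDiagonal' Y, hβ, ?_, ?_, fun s => ?_⟩
  · rw [Matrix.mul_assoc, ← Matrix.mul_assoc T, h1, Matrix.one_mul, e2]
  · rw [Matrix.mul_assoc, ← Matrix.mul_assoc _ _ T, e1, Matrix.one_mul, h2]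
  · have h4 : Matrix.blockDiagonal' Y' * T * V s * (R * Matrix.blockDiagonal' Y) =
        Matrix.blockDiagonal' Y' * (T * V s * R) * Matrix.blockDiagonal' Y := by
      simp only [Matrix.mul_assoc]
    rw [h4]
    refine ⟨?_, fun a x y => ?_⟩
    · rintro ⟨a, x⟩ ⟨b, y⟩ hab
      rw [Matrix.blockDiagonal'_mul_mul_apply]
      have : (T * V s * R).submatrix (Sigma.mk a) (Sigma.mk b) = 0 := by
        ext u v
        exact (h3 s).1 hab
      rw [this, Matrix.mul_zero, Matrix.zero_mul, Matrix.zero_apply]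
    · rw [Matrix.blockDiagonal'_mul_mul_apply]
      have : (T * V s * R).submatrix (Sigma.mk a) (Sigma.mk a) = K a s := by
        ext u v
        exact (h3 s).2 a u v
      rw [this, Matrix.mul_assoc, hY, ← Matrix.mul_assoc, hY'Y, Matrix.one_mul]

theorem HasTriangularForm.of_irreducible {n : ℕ} (V : S → Matrix (Fin n) (Fin n) ℂ) :
    HasTriangularForm V (fun _ : Unit => n) (fun _ => V) := by
  let f : (Σ _ : Unit, Fin n) ≃ Fin n := Equiv.uniqueSigma fun _ : Unit => Fin n
  refine ⟨fun _ => 0, (1 : Matrix (Fin n) (Fin n) ℂ).submatrix f id,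
    (1 : Matrix (Fin n) (Fin n) ℂ).submatrix id f, fun _ _ _ => rfl, ?_, ?_, fun s => ?_⟩
  · rw [Matrix.submatrix_left_mul_submatrix_right, Matrix.one_mul,
      Matrix.submatrix_one_equiv]
  · rw [Matrix.submatrix_mul_equiv 1 1 id f id, Matrix.one_mul, Matrix.submatrix_id_id]
  · have h4 : (1 : Matrix (Fin n) (Fin n) ℂ).submatrix f id * V s *
        (1 : Matrix (Fin n) (Fin n) ℂ).submatrix id f = (V s).submatrix f f := by
      rw [Matrix.submatrix_left_mul_mul_submatrix_right, Matrix.one_mul, Matrix.mul_one]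
    rw [h4]
    exact ⟨fun x y hxy => (lt_irrefl _ hxy).elim, fun a x y => rfl⟩

/-- Triangular forms of an invariant subspace and of its complement combine. -/
theorem HasTriangularForm.sum {V : S → Matrix B B ℂ} {r₁ r₂ : ℕ}
    {R₁ : Matrix B (Fin r₁) ℂ} {T₁ : Matrix (Fin r₁) B ℂ}
    {R₂ : Matrix B (Fin r₂) ℂ} {T₂ : Matrix (Fin r₂) B ℂ}
    (h11 : T₁ * R₁ = 1) (h22 : T₂ * R₂ = 1) (h12 : T₁ * R₂ = 0) (h21 : T₂ * R₁ = 0)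
    (hsum : R₁ * T₁ + R₂ * T₂ = 1) (hV : ∀ s, T₂ * V s * R₁ = 0)
    {d₁ : ι → ℕ} {K₁ : (a : ι) → S → Matrix (Fin (d₁ a)) (Fin (d₁ a)) ℂ}
    {d₂ : ι' → ℕ} {K₂ : (a : ι') → S → Matrix (Fin (d₂ a)) (Fin (d₂ a)) ℂ}
    (H₁ : HasTriangularForm (fun s => T₁ * V s * R₁) d₁ K₁)
    (H₂ : HasTriangularForm (fun s => T₂ * V s * R₂) d₂ K₂) :
    HasTriangularForm V (Sum.elim d₁ d₂) (fun a => Sum.rec (motive := fun a =>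
      S → Matrix (Fin (Sum.elim d₁ d₂ a)) (Fin (Sum.elim d₁ d₂ a)) ℂ) K₁ K₂ a) := by
  obtain ⟨β₁, T₁', R₁', hβ₁, a1, a2, a3⟩ := H₁
  obtain ⟨β₂, T₂', R₂', hβ₂, b1, b2, b3⟩ := H₂
  let f : (Σ a, Fin (Sum.elim d₁ d₂ a)) ≃ (Σ a, Fin (d₁ a)) ⊕ (Σ a, Fin (d₂ a)) :=
    Equiv.sumSigmaDistrib _
  -- Shifting by M puts every level of the complement above all levels of the invariant subspace,
  -- which keeps the levels distinct.
  set M := 1 + ∑ a, β₁ a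
  have hM : ∀ a, β₁ a < M := fun a => by
    have := Finset.single_le_sum (f := β₁) (fun _ _ => Nat.zero_le _) (Finset.mem_univ a)
    omega
  refine ⟨Sum.elim β₁ fun a => β₂ a + M,
    (Matrix.fromRows (T₁' * T₁) (T₂' * T₂)).submatrix f id,
    (Matrix.fromCols (R₁ * R₁') (R₂ * R₂')).submatrix id f, ?_, ?_, ?_, fun s => ?_⟩
  · refine Function.Injective.sumElim hβ₁ (fun a b hab => hβ₂ (Nat.add_right_cancel hab))
      fun a b => ?_
    have := hM a
    omega
  · rw [Matrix.submatrix_left_mul_submatrix_right, Matrix.fromRows_mul_fromCols]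
    have e1 : T₁' * T₁ * (R₁ * R₁') = 1 := by
      rw [Matrix.mul_assoc, ← Matrix.mul_assoc T₁, h11, Matrix.one_mul, a1]
    have e2 : T₁' * T₁ * (R₂ * R₂') = 0 := by
      rw [Matrix.mul_assoc, ← Matrix.mul_assoc T₁, h12, Matrix.zero_mul, Matrix.mul_zero]
    have e3 : T₂' * T₂ * (R₁ * R₁') = 0 := by
      rw [Matrix.mul_assoc, ← Matrix.mul_assoc T₂, h21, Matrix.zero_mul, Matrix.mul_zero]
    have e4 : T₂' * T₂ * (R₂ * R₂') = 1 := by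
      rw [Matrix.mul_assoc, ← Matrix.mul_assoc T₂, h22, Matrix.one_mul, b1]
    rw [e1, e2, e3, e4, Matrix.fromBlocks_one, Matrix.submatrix_one_equiv]
  · rw [Matrix.submatrix_mul_equiv _ _ id f id, Matrix.fromCols_mul_fromRows,
      Matrix.submatrix_id_id]
    rw [Matrix.mul_assoc, ← Matrix.mul_assoc R₁', a2, Matrix.one_mul, Matrix.mul_assoc,
      ← Matrix.mul_assoc R₂', b2, Matrix.one_mul, hsum]
  · have h4 : (Matrix.fromRows (T₁' * T₁) (T₂' * T₂)).submatrix f id * V s *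
        (Matrix.fromCols (R₁ * R₁') (R₂ * R₂')).submatrix id f =
        (Matrix.fromBlocks (T₁' * (T₁ * V s * R₁) * R₁') (T₁' * T₁ * V s * (R₂ * R₂')) 0
          (T₂' * (T₂ * V s * R₂) * R₂')).submatrix f f := by
      have e1 : T₂' * T₂ * V s * (R₁ * R₁') = 0 := by
        rw [show T₂' * T₂ * V s * (R₁ * R₁') = T₂' * (T₂ * V s * R₁) * R₁' by
          simp only [Matrix.mul_assoc], hV, Matrix.mul_zero, Matrix.zero_mul]
      have e2 : Matrix.fromRows (T₁' * T₁) (T₂' * T₂) * V s *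
          Matrix.fromCols (R₁ * R₁') (R₂ * R₂') =
          Matrix.fromBlocks (T₁' * (T₁ * V s * R₁) * R₁') (T₁' * T₁ * V s * (R₂ * R₂')) 0
          (T₂' * (T₂ * V s * R₂) * R₂') := by
        rw [Matrix.fromRows_mul, Matrix.fromRows_mul_fromCols, e1]
        simp only [Matrix.mul_assoc]
      rw [← e2, Matrix.submatrix_left_mul_mul_submatrix_right]
    rw [h4]
    refine ⟨?_, ?_⟩
    · rintro ⟨a | a, x⟩ ⟨b | b, y⟩ hab
      · exact (a3 s).1 hab
      · have h5 : β₂ b + M < β₁ a := hab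
        have := hM a
        omega
      · rfl
      · exact (b3 s).1 (show β₂ b < β₂ a from Nat.lt_of_add_lt_add_right hab)
    · rintro (a | a) x y
      · exact (a3 s).2 a x y
      · exact (b3 s).2 a x y

/-- Every family of matrices has a triangular form with irreducible diagonal blocks. -/
theorem exists_hasTriangularForm_fin (n : ℕ) : ∀ V : S → Matrix (Fin n) (Fin n) ℂ,
    ∃ (ι : Type) (_ : Fintype ι) (_ : DecidableEq ι) (d : ι → ℕ)
      (K : (a : ι) → S → Matrix (Fin (d a)) (Fin (d a)) ℂ),
      (∀ a, 0 < d a) ∧ (∀ a, IsIrreducibleFamily (K a)) ∧ HasTriangularForm V d K := by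
  induction n using Nat.strong_induction_on with
  | _ n ih =>
  intro V
  rcases Nat.eq_zero_or_pos n with rfl | hn
  · refine ⟨Empty, inferInstance, inferInstance, fun _ => 0, fun a => a.elim, fun a => a.elim,
      fun a => a.elim, fun _ => 0, 0, 0, fun a => a.elim, ?_, ?_, fun s => ⟨?_, fun a => a.elim⟩⟩
    · exact Subsingleton.elim _ _
    · exact Subsingleton.elim _ _
    · rintro ⟨a, -⟩
      exact a.elim
  by_cases hirr : IsIrreducibleFamily V
  · exact ⟨Unit, inferInstance, inferInstance, fun _ => n, fun _ => V, fun _ => hn, fun _ => hirr,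
      HasTriangularForm.of_irreducible V⟩
  rw [IsIrreducibleFamily] at hirr
  push Not at hirr
  obtain ⟨P, hP, hinv, hP0, hP1⟩ := hirr
  obtain ⟨r₁, R₁, T₁, hRT₁, h11⟩ := Matrix.exists_factorization_of_idempotent hP
  obtain ⟨r₂, R₂, T₂, hRT₂, h22⟩ := Matrix.exists_factorization_of_idempotent (P := 1 - P)
    (by rw [mul_sub, mul_one, sub_mul, one_mul, hP, sub_self, sub_zero])
  have hT₁ : T₁ * P = T₁ := by rw [← hRT₁, ← Matrix.mul_assoc, h11, Matrix.one_mul]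
  have hR₁ : P * R₁ = R₁ := by rw [← hRT₁, Matrix.mul_assoc, h11, Matrix.mul_one]
  have hT₂ : T₂ * P = 0 := by
    have : T₂ * (1 - P) = T₂ := by rw [← hRT₂, ← Matrix.mul_assoc, h22, Matrix.one_mul]
    rw [Matrix.mul_sub, Matrix.mul_one] at this
    exact sub_eq_self.1 this
  have hR₂ : P * R₂ = 0 := by
    have : (1 - P) * R₂ = R₂ := by rw [← hRT₂, Matrix.mul_assoc, h22, Matrix.mul_one]
    rw [Matrix.sub_mul, Matrix.one_mul] at this
    exact sub_eq_self.1 this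
  have h12 : T₁ * R₂ = 0 := by rw [← hT₁, Matrix.mul_assoc, hR₂, Matrix.mul_zero]
  have h21 : T₂ * R₁ = 0 := by rw [← hR₁, ← Matrix.mul_assoc, hT₂, Matrix.zero_mul]
  have hsum : R₁ * T₁ + R₂ * T₂ = 1 := by rw [hRT₁, hRT₂, add_sub_cancel]
  -- Traces add up the ranks of P and 1 - P. Both are nonzero, hence both smaller than n, and the
  -- induction applies to the invariant subspace and to its complement.
  have hrn : r₁ + r₂ = n := by
    have h := congrArg Matrix.trace hsum
    rw [Matrix.trace_add, Matrix.trace_mul_comm, h11, Matrix.trace_mul_comm R₂, h22] at h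
    simp only [Matrix.trace_one, Fintype.card_fin] at h
    exact_mod_cast h
  have hr₁ : r₁ ≠ 0 := by
    rintro rfl
    exact hP0 (by rw [← hRT₁, Subsingleton.elim R₁ 0, Matrix.zero_mul])
  have hr₂ : r₂ ≠ 0 := by
    rintro rfl
    refine hP1 (sub_eq_zero.1 ?_).symm
    rw [← hRT₂, Subsingleton.elim R₂ 0, Matrix.zero_mul]
  obtain ⟨ι₁, _, _, d₁, K₁, p1, i1, t1⟩ := ih r₁ (by omega) fun s => T₁ * V s * R₁
  obtain ⟨ι₂, _, _, d₂, K₂, p2, i2, t2⟩ := ih r₂ (by omega) fun s => T₂ * V s * R₂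
  refine ⟨ι₁ ⊕ ι₂, inferInstance, inferInstance, _, _, ?_, ?_,
    HasTriangularForm.sum h11 h22 h12 h21 hsum (fun s => ?_) t1 t2⟩
  · rintro (a | a)
    · exact p1 a
    · exact p2 a
  · rintro (a | a)
    · exact i1 a
    · exact i2 a
  · rw [← hR₁, Matrix.mul_assoc, ← Matrix.mul_assoc (V s), hinv, Matrix.mul_assoc P,
      Matrix.mul_assoc P, ← Matrix.mul_assoc T₂, hT₂, Matrix.zero_mul]

theorem exists_hasTriangularForm (V : S → Matrix B B ℂ) :
    ∃ (ι : Type) (_ : Fintype ι) (_ : DecidableEq ι) (d : ι → ℕ)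
      (K : (a : ι) → S → Matrix (Fin (d a)) (Fin (d a)) ℂ),
      (∀ a, 0 < d a) ∧ (∀ a, IsIrreducibleFamily (K a)) ∧ HasTriangularForm V d K := by
  let e := (Fintype.equivFin B).symm
  obtain ⟨ι, i1, i2, d, K, h1, h2, h3⟩ := exists_hasTriangularForm_fin (Fintype.card B)
    fun s => (1 : Matrix B B ℂ).submatrix e id * V s * (1 : Matrix B B ℂ).submatrix id e
  refine ⟨ι, i1, i2, d, K, h1, h2, HasTriangularForm.of_conj ?_ ?_ (fun s => rfl) h3⟩
  · rw [Matrix.submatrix_left_mul_submatrix_right, Matrix.one_mul,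
      Matrix.submatrix_one_equiv]
  · rw [Matrix.submatrix_mul_equiv 1 1 id e id, Matrix.one_mul, Matrix.submatrix_id_id]

end TriangularForms

/-! ### Existence of the canonical form -/

section CanonicalExistence

variable {O I B : Type*} [Fintype O] [Fintype I] [Fintype B]
  [DecidableEq O] [DecidableEq I] [DecidableEq B]
  {ι : Type} [Fintype ι] [DecidableEq ι]

/-- The tensor with the matrices of a family indexed by pairs. -/
def curryFamily {n : Type*} (K : O × I → Matrix n n ℂ) : MPOTensor O I n := fun o i => K (o, i)

/-- The diagonal blocks of a product of block triangular matrices are the products of the diagonal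
blocks, and the trace sees only these. -/
theorem HasTriangularForm.mpo_eq_sum {V : MPOTensor O I B} {d : ι → ℕ}
    {K : (a : ι) → O × I → Matrix (Fin (d a)) (Fin (d a)) ℂ}
    (h : HasTriangularForm (fun s : O × I => V s.1 s.2) d K) (N : ℕ) :
    mpo V N = ∑ a, mpo (curryFamily (K a)) N := by
  obtain ⟨β, T, R, hβ, h1, h2, h3⟩ := h
  have key : ∀ (N : ℕ) (o : Fin N → O) (i : Fin N → I),
      (T * blocked V N o i * R).BlockTriangular (fun x => β x.1) ∧
      ∀ a x y, (T * blocked V N o i * R) ⟨a, x⟩ ⟨a, y⟩ = blocked (curryFamily (K a)) N o i x y := by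
    intro N
    induction N with
    | zero =>
      intro o i
      have : T * blocked V 0 o i * R = 1 := by
        simp only [blocked, List.ofFn_zero, List.prod_nil]
        rw [Matrix.mul_one, h1]
      rw [this]
      refine ⟨Matrix.blockTriangular_one, fun a x y => ?_⟩
      simp [blocked, Matrix.one_apply]
    | succ N ih =>
      intro o i
      have h4 : T * blocked V (N + 1) o i * R = (T * V (o 0) (i 0) * R) *
          (T * blocked V N (fun k => o k.succ) (fun k => i k.succ) * R) := by
        rw [blocked_succ, show (T * V (o 0) (i 0) * R) *
          (T * blocked V N (fun k => o k.succ) (fun k => i k.succ) * R) = T * V (o 0) (i 0) * (R * T) *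
          (blocked V N (fun k => o k.succ) (fun k => i k.succ) * R) by simp only [Matrix.mul_assoc],
          h2, Matrix.mul_one]
        simp only [Matrix.mul_assoc]
      rw [h4]
      have hl := h3 (o 0, i 0)
      have hr := ih (fun k => o k.succ) (fun k => i k.succ)
      refine ⟨hl.1.mul hr.1, fun a x y => ?_⟩
      rw [Matrix.mul_apply, Fintype.sum_sigma, Finset.sum_eq_single a, blocked_succ,
        Matrix.mul_apply]
      · refine Finset.sum_congr rfl fun z _ => ?_
        rw [hl.2, hr.2]
        rfl
      · intro b _ hb
        refine Finset.sum_eq_zero fun z _ => ?_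
        -- A different intermediate block lies strictly below or above a, as β is injective;
        -- triangularity kills the left factor in one case and the right factor in the other.
        rcases lt_or_gt_of_ne fun hab : β b = β a => hb (hβ hab) with hlt | hlt
        · rw [hl.1 (show β (⟨b, z⟩ : Σ a, Fin (d a)).1 < β (⟨a, x⟩ : Σ a, Fin (d a)).1 from hlt),
            zero_mul]
        · rw [hr.1 (show β (⟨a, y⟩ : Σ a, Fin (d a)).1 < β (⟨b, z⟩ : Σ a, Fin (d a)).1 from hlt),
            mul_zero]
      · simp
  ext o i
  rw [mpo_eq_trace_blocked, Matrix.sum_apply,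
    show (blocked V N o i).trace = (T * blocked V N o i * R).trace by
      rw [Matrix.trace_mul_comm, ← Matrix.mul_assoc, h2, Matrix.one_mul],
    Matrix.trace, Fintype.sum_sigma]
  refine Finset.sum_congr rfl fun a _ => ?_
  rw [mpo_eq_trace_blocked]
  exact Finset.sum_congr rfl fun x _ => (key N o i).2 a x x

/-- Triangular forms in which the non-zero diagonal blocks are copies of `A j`. -/
theorem HasTriangularForm.blockTriangularReduction {V : MPOTensor O I B} {g : ℕ} {D m : Fin g → ℕ}
    {A : (j : Fin g) → MPOTensor O I (Fin (D j))} {Z : Type} [Fintype Z] [DecidableEq Z]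
    {d : (Σ j, Fin (m j)) ⊕ Z → ℕ} (hd : ∀ a, d (Sum.inl a) = D a.1)
    {K : (a : (Σ j, Fin (m j)) ⊕ Z) → O × I → Matrix (Fin (d a)) (Fin (d a)) ℂ}
    (h : HasTriangularForm (fun s : O × I => V s.1 s.2) d K)
    (hA : ∀ a s x y, K (Sum.inl a) s x y = A a.1 s.1 s.2 (Fin.cast (hd a) x) (Fin.cast (hd a) y))
    (hZ : ∀ z s, K (Sum.inr z) s = 0) : BlockTriangularReduction V (multiplicitySum m A) := by
  obtain ⟨β, T, R, hβ, h1, h2, h3⟩ := h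
  let nz := Fintype.card (Σ z, Fin (d (Sum.inr z)))
  -- The copies of the A j are rearranged into the index type of `multiplicitySum`, and all zero
  -- blocks are merged into one range of indices.
  let f : (Σ a, Fin (d a)) ≃ (Σ j : Fin g, Fin (m j) × Fin (D j)) ⊕ Fin nz :=
    (Equiv.sumSigmaDistrib fun a => Fin (d a)).trans (Equiv.sumCongr
      ((Equiv.sigmaCongrRight fun a => finCongr (hd a)).trans
        ((Equiv.sigmaAssoc fun (j : Fin g) (_ : Fin (m j)) => Fin (D j)).trans
          (Equiv.sigmaCongrRight fun j => Equiv.sigmaEquivProd _ _)))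
      (Fintype.equivFin _))
  have hf1 : ∀ a x, f ⟨Sum.inl a, x⟩ = Sum.inl ⟨a.1, (a.2, Fin.cast (hd a) x)⟩ := fun a x => rfl
  have hf2 : ∀ z x, f ⟨Sum.inr z, x⟩ = Sum.inr (Fintype.equivFin _ ⟨z, x⟩) := fun z x => rfl
  have hcard : Fintype.card B = Fintype.card (Σ a, Fin (d a)) := by
    have h4 := congrArg Matrix.trace h2
    rw [Matrix.trace_mul_comm, h1] at h4
    simp only [Matrix.trace_one] at h4
    exact_mod_cast h4.symm
  let e₀ : B ≃ Σ a, Fin (d a) := Fintype.equivOfCardEq hcard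
  refine ⟨nz, e₀.trans f, ⟨T.submatrix e₀ id, R.submatrix id e₀, ?_, ?_⟩, fun y => β (f.symm y).1,
    fun o i => ?_⟩
  · rw [Matrix.submatrix_left_mul_submatrix_right, h1, Matrix.submatrix_one_equiv]
  · rw [Matrix.submatrix_mul_equiv R T id e₀ id, h2, Matrix.submatrix_id_id]
  · have h4 : Matrix.reindex (e₀.trans f) (e₀.trans f)
        (T.submatrix e₀ id * V o i * R.submatrix id e₀) =
        (T * V o i * R).submatrix f.symm f.symm := by
      rw [Matrix.submatrix_left_mul_mul_submatrix_right, Matrix.reindex_apply,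
        Matrix.submatrix_submatrix]
      congr 1 <;> · funext x; simp
    have h5 := h3 (o, i)
    change Matrix.BlockTriangular (Matrix.reindex (e₀.trans f) (e₀.trans f)
        (T.submatrix e₀ id * V o i * R.submatrix id e₀)) (fun y => β (f.symm y).1) ∧ ∀ x y,
        Matrix.fromBlocks (multiplicitySum m A o i) 0 0 (0 : Matrix (Fin nz) (Fin nz) ℂ) x y =
        if β (f.symm x).1 = β (f.symm y).1 then Matrix.reindex (e₀.trans f) (e₀.trans f)
          (T.submatrix e₀ id * V o i * R.submatrix id e₀) x y else 0
    rw [h4]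
    refine ⟨fun x y hxy => h5.1 hxy, fun x y => ?_⟩
    obtain ⟨u, rfl⟩ := f.surjective x
    obtain ⟨v, rfl⟩ := f.surjective y
    simp only [Matrix.submatrix_apply, Equiv.symm_apply_apply]
    obtain ⟨a, x⟩ := u
    obtain ⟨b, y⟩ := v
    by_cases hab : a = b
    · subst hab
      rw [if_pos rfl, h5.2]
      rcases a with a | z
      · rw [hf1, hf1, hA, Matrix.fromBlocks_apply₁₁, multiplicitySum,
          Matrix.blockDiagonal'_apply_eq, Matrix.kroneckerMap_apply]
        simp
      · rw [hf2, hf2, hZ, Matrix.fromBlocks_apply₂₂, Matrix.zero_apply, Matrix.zero_apply]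
    · rw [if_neg fun h => hab (hβ h)]
      rcases a with a | z <;> rcases b with b | z'
      · rw [hf1, hf1, Matrix.fromBlocks_apply₁₁, multiplicitySum]
        obtain ⟨j, q⟩ := a
        obtain ⟨j', q'⟩ := b
        by_cases hj : j = j'
        · subst hj
          rw [Matrix.blockDiagonal'_apply_eq, Matrix.kroneckerMap_apply, Matrix.one_apply_ne,
            zero_mul]
          rintro rfl
          exact hab rfl
        · rw [Matrix.blockDiagonal'_apply_ne _ _ _ hj]
      · rfl
      · rfl
      · rfl

theorem mpo_eq_zero {V : MPOTensor O I B} (h : ∀ o i, V o i = 0) {N : ℕ} (hN : 1 ≤ N) :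
    mpo V N = 0 := by
  rw [mpo_smul (V := V) (z := 0) fun o i => by rw [zero_smul, h], zero_pow (by omega), zero_smul]

theorem AreSimilar.refl {S n : Type*} [Fintype n] [DecidableEq n] (K : S → Matrix n n ℂ) :
    AreSimilar K K :=
  ⟨1, 1, by simp, by simp, by simp⟩

theorem AreSimilar.symm {S m n : Type*} [Fintype m] [Fintype n] [DecidableEq m] [DecidableEq n]
    {K : S → Matrix m m ℂ} {L : S → Matrix n n ℂ} (h : AreSimilar K L) : AreSimilar L K := by
  obtain ⟨Y, Y', h1, h2, h3⟩ := h
  refine ⟨Y', Y, h2, h1, fun s => ?_⟩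
  rw [← Matrix.mul_one (Y' * K s), ← h1, Matrix.mul_assoc, ← Matrix.mul_assoc (K s), h3,
    Matrix.mul_assoc Y, ← Matrix.mul_assoc, h2, Matrix.one_mul]

theorem AreSimilar.trans {S l m n : Type*} [Fintype l] [Fintype m] [Fintype n] [DecidableEq l]
    [DecidableEq m] [DecidableEq n] {K : S → Matrix l l ℂ} {L : S → Matrix m m ℂ}
    {M : S → Matrix n n ℂ} (h : AreSimilar K L) (h' : AreSimilar L M) : AreSimilar K M := by
  obtain ⟨Y, Y', h1, h2, h3⟩ := h
  obtain ⟨Z, Z', g1, g2, g3⟩ := h'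
  refine ⟨Y * Z, Z' * Y', ?_, ?_, fun s => ?_⟩
  · rw [Matrix.mul_assoc, ← Matrix.mul_assoc Z, g1, Matrix.one_mul, h1]
  · rw [Matrix.mul_assoc, ← Matrix.mul_assoc Y', h2, Matrix.one_mul, g2]
  · rw [← Matrix.mul_assoc, h3, Matrix.mul_assoc, g3, Matrix.mul_assoc]

/-- A tensor that generates an isometry can be brought to canonical form. -/
theorem GeneratesSMPI.exists_canonicalForm [Nonempty I] {V : MPOTensor O I B} {c : ℝ}
    (hV : GeneratesSMPI V c) :
    ∃ C : CanonicalData O I, C.IsCanonicalFormOf V ∧ BlockTriangularReduction V C.tensor := by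
  classical
  obtain ⟨ι, _, _, d, K, hpos, hirr, htri⟩ :=
    exists_hasTriangularForm fun s : O × I => V s.1 s.2
  have hnil := fun a a' => hV.isNilpotent (W := fun a => curryFamily (K a))
    (fun N _ => htri.mpo_eq_sum N) a a'
  have hirr' : ∀ a, IsIrreducibleFamily (tensorFamily (curryFamily (K a))) := fun a =>
    (isIrreducibleFamily_smul_iff (L := K a) (tensorFamily_scalar_ne_zero (I := I))
      fun _ => rfl).2 (hirr a)
  -- A nonzero irreducible block cannot have a nilpotent transfer matrix, so the isometry condition
  -- has already normalized it.
  have hnf : ∀ a, K a ≠ 0 → IsNormalizedFamily (tensorFamily (curryFamily (K a))) := by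
    intro a ha
    refine ⟨hirr' a, ?_, fun h => ha ?_⟩
    · rw [mixedTransfer_tensorFamily]
      exact hnil a a
    · have : Nonempty (Fin (d a)) := ⟨⟨0, hpos a⟩⟩
      funext s
      have h0 := (hirr' a).eq_zero_of_isNilpotent h s
      exact (smul_eq_zero.1 h0).resolve_left (tensorFamily_scalar_ne_zero (I := I))
  have hoff : ∀ a b, K a ≠ 0 → K b ≠ 0 → ¬ AreSimilar (K a) (K b) →
      IsNilpotent (transfer (curryFamily (K a)) (curryFamily (K b))) := by
    intro a b ha hb hab
    have h := (hnf a ha).isNilpotent_or_similar (hnf b hb)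
      (by rw [mixedTransfer_tensorFamily]; exact hnil a b)
    rw [mixedTransfer_tensorFamily] at h
    refine h.resolve_right fun hsim => hab ?_
    obtain ⟨Y, Y', h1, h2, hY⟩ := hsim
    refine ⟨Y, Y', h1, h2, fun s => ?_⟩
    have := hY s
    rw [tensorFamily, tensorFamily, Matrix.smul_mul, Matrix.mul_smul] at this
    exact smul_right_injective _ (tensorFamily_scalar_ne_zero (I := I)) this
  -- The nonzero blocks are sorted by similarity: one representative per class becomes a block of
  -- the canonical form, and the size of the class its multiplicity. The coefficients can be 1
  -- because no rescaling is needed.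
  let st : Setoid {a // K a ≠ 0} :=
    ⟨fun a b => AreSimilar (K a) (K b), fun _ => AreSimilar.refl _, AreSimilar.symm,
      AreSimilar.trans⟩
  let eQ := Fintype.equivFin (Quotient st)
  let cls : {a // K a ≠ 0} → Fin (Fintype.card (Quotient st)) := fun a => eQ (Quotient.mk st a)
  let rep : Fin (Fintype.card (Quotient st)) → {a // K a ≠ 0} := fun j => (eQ.symm j).out
  have hcls : ∀ j, cls (rep j) = j := fun j => by
    simp only [cls, rep, Quotient.out_eq, Equiv.apply_symm_apply]
  have hrep : ∀ a : {a // K a ≠ 0}, AreSimilar (K a) (K (rep (cls a))) := by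
    intro a
    have : Quotient.mk st a = Quotient.mk st (rep (cls a)) := eQ.injective (hcls (cls a)).symm
    exact Quotient.exact this
  have hne : ∀ j j', j ≠ j' → ¬ AreSimilar (K (rep j)) (K (rep j')) := by
    intro j j' hjj h
    apply hjj
    rw [← hcls j, ← hcls j']
    exact congrArg eQ (Quotient.sound (s := st) h)
  let C : CanonicalData O I :=
    { g := Fintype.card (Quotient st)
      D := fun j => d (rep j)
      mult := fun j => Fintype.card {a // cls a = j}
      mult_pos := fun j => Fintype.card_pos_iff.2 ⟨⟨rep j, hcls j⟩⟩
      coeff := fun _ _ => 1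
      coeff_ne_zero := fun _ _ => one_ne_zero
      block := fun j => curryFamily (K (rep j)) }
  have hCt : C.tensor = multiplicitySum C.mult C.block := (multiplicitySum_eq _ _).symm
  let ε : (Σ j, Fin (C.mult j)) ⊕ {a // ¬ K a ≠ 0} ≃ ι :=
    (Equiv.sumCongr ((Equiv.sigmaCongrRight fun j => (Fintype.equivFin _).symm).trans
      (Equiv.sigmaFiberEquiv cls)) (Equiv.refl _)).trans (Equiv.sumCompl _)
  let d' : (Σ j, Fin (C.mult j)) ⊕ {a // ¬ K a ≠ 0} → ℕ :=
    Sum.elim (fun a => C.D a.1) (fun z => d z)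
  -- A change of basis inside each diagonal block replaces it by the representative of its class, so
  -- equivalent blocks become literally equal.
  have htri' := (htri.reindex ε).congr_similar
    (d' := d') (K' := fun a => Sum.rec (motive := fun a => O × I → Matrix (Fin (d' a)) (Fin (d' a)) ℂ)
      (fun a => K (rep a.1)) (fun z => K z) a) (by
    rintro (⟨j, q⟩ | z)
    · have h := hrep ((Fintype.equivFin {a // cls a = j}).symm q).1
      rw [((Fintype.equivFin {a // cls a = j}).symm q).2] at h
      exact h
    · exact AreSimilar.refl _)
  have hmpo : ∀ N : ℕ, 1 ≤ N → mpo C.tensor N = mpo V N := by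
    intro N hN
    rw [htri'.mpo_eq_sum, Fintype.sum_sum_type, Finset.sum_eq_zero (s := Finset.univ)
      (f := fun z : {a // ¬ K a ≠ 0} => _) fun z _ => mpo_eq_zero (fun o i => ?_) hN, add_zero]
    · refine (mpo_weightedSum C.mult C.coeff C.block N).trans (Finset.sum_congr rfl fun a _ => ?_)
      simp only [C, one_smul]
      rfl
    · exact congrFun (not_not.1 z.2) (o, i)
  obtain ⟨L₀, -, -, -, htrace⟩ := exists_stable_blocking (W := C.block)
    (fun j => hnf _ (rep j).2) fun j j' hjj => hoff _ _ (rep j).2 (rep j').2 (hne j j' hjj)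
  refine ⟨C, ⟨⟨fun j => (hnf _ (rep j).2).isNormalTensor, fun N hN => ?_, L₀, fun N hN =>
    linearIndependent_mpo (htrace N hN.le)⟩, hmpo⟩, ?_⟩
  · rw [← hmpo N hN]
    have := mpo_weightedSum C.mult C.coeff C.block N
    rw [show C.tensor = weightedSum C.mult C.coeff C.block from rfl, this]
    refine Submodule.sum_mem _ fun a _ => ?_
    rw [mpo_smul (V := C.block a.1) fun _ _ => rfl]
    exact Submodule.smul_mem _ _ (Submodule.subset_span ⟨a.1, rfl⟩)
  · rw [hCt]
    exact htri'.blockTriangularReduction (fun _ => rfl) (fun _ _ _ _ => rfl)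
      fun z s => congrFun (not_not.1 z.2) s

end CanonicalExistence

theorem mainTheorem6 {O I B : Type*} [Fintype O] [Fintype I] [Fintype B]
    [DecidableEq O] [DecidableEq I] [DecidableEq B] [Nonempty I]
    (V : MPOTensor O I B) (c : ℝ) (hV : GeneratesSMPI V c) :
    -- `V` can be brought to canonical form
    (∃ C : CanonicalData O I, C.IsCanonicalFormOf V ∧ BlockTriangularReduction V C.tensor) ∧
    -- the structure of every canonical form of `V`
    ∀ C : CanonicalData O I, C.IsCanonicalFormOf V →
      -- the coefficients are phases `φ j`, to be absorbed into the blocks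
      ∃ φ : Fin C.g → ℂ, (∀ j, ‖φ j‖ = 1) ∧ (∀ j q, C.coeff j q = φ j) ∧
      ∃ W : (j : Fin C.g) → MPOTensor O I (Fin (C.D j)),
        (∀ j o i, W j o i = φ j • C.block j o i) ∧
        -- (i)
        IsBNT W V ∧ C.tensor = multiplicitySum C.mult W ∧
        (∀ j j', j ≠ j' → IsNilpotent (transfer (W j) (W j'))) ∧
        -- (ii)
        ((∑ j, C.mult j ^ 2 : ℕ) : ℝ) = c ∧
        -- (iii), with the decomposition in (i) for the blocked tensor
        ∃ L₀ : ℕ, 1 ≤ L₀ ∧ ∀ L : ℕ, L₀ ≤ L →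
          IsBNT (fun j => blocked (W j) L) (blocked V L) ∧
          blocked C.tensor L = multiplicitySum C.mult (fun j => blocked (W j) L) ∧
          (∀ j j', j ≠ j' → WeaklyOrthogonal (blocked (W j) L) (blocked (W j') L)) ∧
          ∀ j, (transfer (blocked (W j) L) (blocked (W j) L)).charpoly.rootMultiplicity 1 = 1 ∧
            spectralRadius ℂ (transfer (blocked (W j) L) (blocked (W j) L)) = 1 ∧
            transfer (blocked (W j) L) (blocked (W j) L) ^ 2 =
              transfer (blocked (W j) L) (blocked (W j) L) := by
  exact ⟨hV.exists_canonicalForm, fun C hC => C.structure_of_isCanonicalForm hV hC⟩
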